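/- **Theorem (equivariance of Tulczyjew's diffeomorphism).** Let $Q$ be a smooth finite-dimensional manifold and let $G$ be a Lie group, with Lie algebra $\mathfrak g=T_eG$, acting smoothly on $Q$. A smooth action $\phi$ of $G$ on a manifold $M$ has the infinitesimal generators $\xi_M(x)=\frac{d}{dt}\big|_{t=0}\phi_{\exp(t\xi)}(x)$, $\xi\in\mathfrak g$. It lifts to $TM$ by $g\,v_x=T_x\phi_g(v_x)$ and to $T^*M$ by $g\,\alpha_x=\alpha_x\circ T_{gx}\phi_{g^{-1}}$. Apply this repeatedly to lift the action on $Q$ to $TQ$ and $T^*Q$, then to $TT^*Q$ (tangent lift of the action on $T^*Q$), to $T^*TQ$ (cotangent lift of the action on $TQ$) and to $T^*T^*Q$ (cotangent lift of the action on $T^*Q$). For a manifold $M$, let $\pi_M:T^*M\to M$ and $\tau_M:TM\to M$ be the projections, let $\omega_M=-d\lambda_M$ be the canonical symplectic form of $T^*M$, where $\lambda_M$ is the Liouville one-form, and let $$\langle J_{T^*M}(\alpha_x),\xi\rangle=\langle\alpha_x,\xi_M(x)\rangle ,\qquad \alpha_x\in T^*_xM,\ \xi\in\mathfrak g .$$ This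 defines $J_{T^*Q}$, $J_{T^*TQ}$ and $J_{T^*T^*Q}$. Put $\langle J_{TT^*Q}(V),\xi\rangle=V\big((J_{T^*Q})_\xi\big)$ for $V\in TT^*Q$, where $(J_{T^*Q})_\xi=\langle J_{T^*Q}(\cdot),\xi\rangle$. Let $b_{\omega_Q}:TT^*Q\to T^*T^*Q$ be given by $\langle b_{\omega_Q}(V),W\rangle=\omega_Q(V,W)$, and let $\omega_Q^c$ be the complete lift of $\omega_Q$ to $TT^*Q$, that is, $\omega_Q^c=-\,b_{\omega_Q}^*\,\omega_{T^*Q}$. Let $\mathsf v^*:T^*TQ\to T^*Q$ be given by $\langle \mathsf v^*(\alpha_{v_q}),w_q\rangle=\langle\alpha_{v_q},\frac{d}{ds}\big|_{s=0}(v_q+s\,w_q)\rangle$, and let $\langle\cdot,\cdot\rangle^T:TT^*Q\times_{TQ}TTQ\to\mathbb R$ be the tangent map (fibre component) of the pairing $T^*Q\times_QTQ\to\mathbb R$. Then: 1. The lifted action on $(TT^*Q,\omega_Q^c)$ is Hamiltonian with momentum map $J_{TT^*Q}$, and the lifted action on $(T^*TQ,\omega_{TQ})$ is Hamiltonian with momentum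 map $J_{T^*TQ}$. Here an action $\phi$ on $(M,\omega)$ is Hamiltonian with momentum map $J:M\to\mathfrak g^*$ if it is smooth and preserves $\omega$, $J$ is smooth, $i_{\xi_M}\omega=d\langle J,\xi\rangle$ for all $\xi\in\mathfrak g$, and $J(gx)=Ad^*_{g^{-1}}J(x)$ for all $g\in G$, $x\in M$. 2. There is exactly one map $R:T^*TQ\to T^*T^*Q$ such that, for every $\alpha_{v_q}\in T^*TQ$, the covector $R(\alpha_{v_q})$ lies over $\mathsf v^*(\alpha_{v_q})$ and $$\langle R(\alpha_{v_q}),W\rangle=-\langle\alpha_{v_q},\bar W\rangle+\langle W,\bar W\rangle^{T}$$ for all $W\in T_{\mathsf v^*(\alpha_{v_q})}T^*Q$ and $\bar W\in T_{v_q}TQ$ with $T\tau_Q(\bar W)=T\pi_Q(W)$. This $R$ is a diffeomorphism, it is $G$-equivariant, and $J_{T^*T^*Q}\circ R=-J_{T^*TQ}$. 3. Tulczyjew's map $A_Q=R^{-1}\circ b_{\omega_Q}:TT^*Q\to T^*TQ$ is a diffeomorphism, it is $G$-equivariant for the lifted actions, and $$J_{TT^*Q}=J_{T^*TQ}\circ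 A_Q .$$ -/

import Mathlib

open Bundle
open scoped Manifold ContDiff

noncomputable section

namespace Tulczyjew

section Manifolds

variable {E : Type*} [NormedAddCommGroup E] [NormedSpace ℝ E]
  {H : Type*} [TopologicalSpace H] (I : ModelWithCorners ℝ E H)
  (M : Type*) [TopologicalSpace M] [ChartedSpace H M] [IsManifold I ∞ M]

/-- The fibre `T*_x M` of the cotangent bundle: continuous linear functionals on `T_x M`. -/
abbrev CotangentSpace {M : Type*} [TopologicalSpace M] [ChartedSpace H M] (x : M) : Type _ :=
  TangentSpace I x →L[ℝ] Bundle.Trivial M ℝ x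

/-- The cotangent bundle `T*M`, with the topology, charts and smooth vector bundle structure that
Mathlib gives to the bundle of homomorphisms from `TM` to the trivial line bundle. -/
abbrev CotangentBundle : Type _ :=
  TotalSpace (E →L[ℝ] ℝ) (fun x : M => CotangentSpace I x)

/-- The model with corners of the manifold `T*M`. -/
abbrev cotangentModel : ModelWithCorners ℝ (E × (E →L[ℝ] ℝ)) (ModelProd H (E →L[ℝ] ℝ)) :=
  I.prod 𝓘(ℝ, E →L[ℝ] ℝ)

/-- The fibre product `T*M ×_M TM`, as the total space of the Whitney sum of `T*M` and `TM`. -/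
abbrev CotangentTangentBundle : Type _ :=
  TotalSpace ((E →L[ℝ] ℝ) × E)
    ((fun x : M => CotangentSpace I x) ×ᵇ (TangentSpace I : M → Type _))

/-- The model with corners of the manifold `T*M ×_M TM`. -/
abbrev cotangentTangentModel :
    ModelWithCorners ℝ (E × ((E →L[ℝ] ℝ) × E)) (ModelProd H ((E →L[ℝ] ℝ) × E)) :=
  I.prod 𝓘(ℝ, (E →L[ℝ] ℝ) × E)

variable {M}

/-- The value `⟨α, v⟩ ∈ ℝ` of a covector on a tangent vector. -/
def eval (α : CotangentBundle I M) (v : TangentSpace I α.1) : ℝ := α.2 v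

/-! ### Differential forms -/

/-- The expression of a one-form `θ` in the preferred chart at `x`: the pullback of `θ` by the
inverse of the chart, a function on the model vector space with values in its dual. -/
def oneFormInChart (θ : ∀ x : M, CotangentSpace I x) (x : M) (y : E) : E →L[ℝ] ℝ :=
  (θ ((extChartAt I x).symm y) : TangentSpace I ((extChartAt I x).symm y) →L[ℝ] ℝ) ∘L
    (mfderiv 𝓘(ℝ, E) I (extChartAt I x).symm y : E →L[ℝ] _)

/-- The exterior derivative of a one-form on a manifold without boundary, computed in the
preferred chart at `x`: in the chart, `dθ (v, w) = (D_v θ)(w) - (D_w θ)(v)`. -/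
def oneFormExtDeriv (θ : ∀ x : M, CotangentSpace I x) (x : M) :
    TangentSpace I x →L[ℝ] TangentSpace I x →L[ℝ] ℝ :=
  let B : E →L[ℝ] E →L[ℝ] ℝ := fderiv ℝ (oneFormInChart I θ x) (extChartAt I x x)
  let D : TangentSpace I x →L[ℝ] E := mfderiv I 𝓘(ℝ, E) (extChartAt I x) x
  (ContinuousLinearMap.precomp ℝ D) ∘L (B - B.flip) ∘L D

/-- The pullback by `f : M → N` of a field of bilinear forms on `N`. -/
def bilinPullback {E' : Type*} [NormedAddCommGroup E'] [NormedSpace ℝ E']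
    {H' : Type*} [TopologicalSpace H'] (I' : ModelWithCorners ℝ E' H')
    {N : Type*} [TopologicalSpace N] [ChartedSpace H' N] (f : M → N)
    (Ω : ∀ y : N, TangentSpace I' y →L[ℝ] TangentSpace I' y →L[ℝ] ℝ) (x : M) :
    TangentSpace I x →L[ℝ] TangentSpace I x →L[ℝ] ℝ :=
  (ContinuousLinearMap.precomp ℝ (mfderiv I I' f x)) ∘L (Ω (f x)) ∘L (mfderiv I I' f x)

variable (M) in
/-- The Liouville one-form of `T*M`: `λ_α (W) = ⟨α, T π_M (W)⟩`. -/
def liouvilleForm (α : CotangentBundle I M) : CotangentSpace (cotangentModel I) α :=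
  (α.2 : TangentSpace I α.1 →L[ℝ] ℝ) ∘L
    mfderiv (cotangentModel I) I (fun β : CotangentBundle I M => β.1) α

variable (M) in
/-- The canonical symplectic form `ω_M = - dλ_M` of `T*M` (in coordinates `dq ∧ dp`). -/
def canonicalForm (α : CotangentBundle I M) :
    TangentSpace (cotangentModel I) α →L[ℝ] TangentSpace (cotangentModel I) α →L[ℝ] ℝ :=
  -oneFormExtDeriv (cotangentModel I) (liouvilleForm I M) α

/-- The morphism `b_Ω : TM → T*M` given by `⟨b_Ω v, w⟩ = Ω (v, w)`. -/
def flat (Ω : ∀ x : M, TangentSpace I x →L[ℝ] TangentSpace I x →L[ℝ] ℝ)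
    (V : TangentBundle I M) : CotangentBundle I M :=
  ⟨V.1, Ω V.1 V.2⟩

/-- The complete lift `Ω^c` to `TM` of a closed two-form `Ω` on `M`: the form on `TM` given by
`b_Ω^* ω_M = - Ω^c`, where `ω_M` is the canonical symplectic form of `T*M`. -/
def completeLift (Ω : ∀ x : M, TangentSpace I x →L[ℝ] TangentSpace I x →L[ℝ] ℝ)
    (V : TangentBundle I M) :
    TangentSpace I.tangent V →L[ℝ] TangentSpace I.tangent V →L[ℝ] ℝ :=
  -bilinPullback I.tangent (cotangentModel I) (flat I Ω) (canonicalForm I M) V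

/-! ### The map `R` -/

/-- The vertical lift `w ↦ (w)^v_{v}` from `T_x M` to `T_v (TM)`: the derivative at `v`, in the
direction `w`, of the inclusion of the fibre `T_x M` into `TM`. -/
def verticalLift (x : M) (v : TangentSpace I x) :
    TangentSpace I x →L[ℝ] TangentSpace I.tangent (⟨x, v⟩ : TangentBundle I M) :=
  (mfderiv 𝓘(ℝ, E) I.tangent (fun u : E => (⟨x, u⟩ : TangentBundle I M)) (v : E) : E →L[ℝ] _)

/-- The projection `v^* : T*TM → T*M`, `⟨v^* α, w⟩ = ⟨α, (w)^v_{v}⟩` for `α` over `v`. -/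
def vStar (α : CotangentBundle I.tangent (TangentBundle I M)) : CotangentBundle I M :=
  ⟨α.1.1, (α.2 : TangentSpace I.tangent α.1 →L[ℝ] ℝ) ∘L verticalLift I α.1.1 α.1.2⟩

variable (M) in
/-- The usual pairing `T*M ×_M TM → ℝ`. -/
def pairing (z : CotangentTangentBundle I M) : ℝ := z.2.1 z.2.2

/-- The tangent map of the pairing `T*M ×_M TM → ℝ`, with values in `T_r ℝ = ℝ`. -/
def tangentPairing (z : CotangentTangentBundle I M) :
    TangentSpace (cotangentTangentModel I) z →L[ℝ] ℝ :=
  mfderiv (cotangentTangentModel I) 𝓘(ℝ, ℝ) (pairing I M) z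

variable (M) in
/-- The first projection `T*M ×_M TM → T*M`. -/
def toCotangent (z : CotangentTangentBundle I M) : CotangentBundle I M := ⟨z.1, z.2.1⟩

variable (M) in
/-- The second projection `T*M ×_M TM → TM`. -/
def toTangent (z : CotangentTangentBundle I M) : TangentBundle I M := ⟨z.1, z.2.2⟩

/-- The condition that determines `R : T*TM → T*T*M`. For `α` in `T*TM` over `v`, the covector
`R α` lies over `v^* α`, and
`⟨R α, W⟩ = - ⟨α, W'⟩ + ⟨W, W'⟩^T` for all `W ∈ T_{v^* α} T*M` and `W' ∈ T_v TM` that have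
the same projection to `TM`.
The tangent space of `T*M ×_M TM` at `(v^* α, v)` is the space of these pairs `(W, W')`, by means
of the tangent maps of the two projections, and `⟨W, W'⟩^T` is the derivative of the pairing
on it; so the condition below runs over the tangent vectors `Z` of `T*M ×_M TM` at `(v^* α, v)`. -/
def IsR (R : CotangentBundle I.tangent (TangentBundle I M) →
    CotangentBundle (cotangentModel I) (CotangentBundle I M)) : Prop :=
  ∀ α : CotangentBundle I.tangent (TangentBundle I M),
    ∃ β : TangentSpace (cotangentModel I) (vStar I α) →L[ℝ] ℝ,
      R α = ⟨vStar I α, β⟩ ∧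
      ∀ Z : TangentSpace (cotangentTangentModel I)
          (⟨α.1.1, ((vStar I α).2, α.1.2)⟩ : CotangentTangentBundle I M),
        β (mfderiv (cotangentTangentModel I) (cotangentModel I) (toCotangent I M) _ Z) =
          - eval I.tangent α (mfderiv (cotangentTangentModel I) I.tangent (toTangent I M) _ Z)
            + tangentPairing I _ Z

end Manifolds

/-! ### Actions, their lifts and momentum maps

An action is given as a family `Φ : G → M → M` of maps. -/

section Actions

variable {EG : Type*} [NormedAddCommGroup EG] [NormedSpace ℝ EG]
  {HG : Type*} [TopologicalSpace HG] (IG : ModelWithCorners ℝ EG HG)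
  {G : Type*} [TopologicalSpace G] [ChartedSpace HG G] [Group G]
  {E : Type*} [NormedAddCommGroup E] [NormedSpace ℝ E]
  {H : Type*} [TopologicalSpace H] (I : ModelWithCorners ℝ E H)
  {M : Type*} [TopologicalSpace M] [ChartedSpace H M] [IsManifold I ∞ M]

/-- The lifted action on `TM`: `g v = T Φ_g (v)`. -/
def tangentLift (Φ : G → M → M) (g : G) : TangentBundle I M → TangentBundle I M :=
  tangentMap I I (Φ g)

/-- The lifted action on `T*M`: for `α ∈ T*_x M`, the covector `g α` at `g x` is the composition
of `T_{g x} Φ_{g⁻¹} : T_{g x} M → T_x M` with `α`. -/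
def cotangentLift (Φ : G → M → M) (g : G) (α : CotangentBundle I M) : CotangentBundle I M :=
  ⟨Φ g α.1, (α.2 : TangentSpace I α.1 →L[ℝ] ℝ) ∘L
    (mfderiv I I (Φ g⁻¹) (Φ g α.1) : TangentSpace I (Φ g α.1) →L[ℝ] TangentSpace I α.1)⟩

/-- The infinitesimal generators of an action: `ξ ↦ ξ_M (x)` is the derivative at the identity of
the orbit map `g ↦ g x`. -/
def generator (Φ : G → M → M) (x : M) : GroupLieAlgebra IG G →L[ℝ] TangentSpace I x :=
  (mfderiv IG I (fun g => Φ g x) (1 : G) : _ →L[ℝ] TangentSpace I (Φ 1 x))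

variable (G) in
/-- The adjoint action `Ad_g`: the derivative at the identity of `h ↦ g h g⁻¹`. -/
def adjoint (g : G) : GroupLieAlgebra IG G →L[ℝ] GroupLieAlgebra IG G :=
  (mfderiv IG IG (fun h => g * h * g⁻¹) (1 : G) :
    _ →L[ℝ] TangentSpace IG (g * 1 * g⁻¹))

/-- The momentum map of a cotangent lift, `⟨J (α), ξ⟩ = ⟨α, ξ_M (x)⟩` for `α ∈ T*_x M`.
Momentum maps take values in the dual of the Lie algebra `T_1 G`; as a vector space, `T_1 G` is
the model space `EG`, whose norm makes the dual a normed space. -/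
def cotangentMomentum (Φ : G → M → M) (α : CotangentBundle I M) : EG →L[ℝ] ℝ :=
  (α.2 : TangentSpace I α.1 →L[ℝ] ℝ) ∘L generator IG I Φ α.1

/-- The momentum map of the tangent lift of a Hamiltonian action with momentum map `J`,
`⟨J_{TM} (v), ξ⟩ = v (J_ξ)`, that is, `J_{TM} (v) = dJ (v)`. -/
def tangentMomentum (J : M → EG →L[ℝ] ℝ) (V : TangentBundle I M) : EG →L[ℝ] ℝ :=
  mfderiv I 𝓘(ℝ, EG →L[ℝ] ℝ) J V.1 V.2

/-- `Φ` is a smooth action that preserves `Ω`, and `J` is an `Ad^*`-equivariant momentum map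
for it. -/
structure IsHamiltonianAction
    (Ω : ∀ x : M, TangentSpace I x →L[ℝ] TangentSpace I x →L[ℝ] ℝ)
    (Φ : G → M → M) (J : M → EG →L[ℝ] ℝ) : Prop where
  one_act : ∀ x, Φ 1 x = x
  mul_act : ∀ g h x, Φ (g * h) x = Φ g (Φ h x)
  contMDiff_act : ContMDiff (IG.prod I) I ∞ (fun p : G × M => Φ p.1 p.2)
  symplectic : ∀ g, bilinPullback I I (Φ g) Ω = Ω
  contMDiff_momentum : ContMDiff I 𝓘(ℝ, EG →L[ℝ] ℝ) ∞ J
  /-- `i_{ξ_M} Ω = dJ_ξ`, where `J_ξ (x) = ⟨J (x), ξ⟩`. -/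
  momentum : ∀ (x : M) (ξ : GroupLieAlgebra IG G) (v : TangentSpace I x),
    Ω x (generator IG I Φ x ξ) v = (mfderiv I 𝓘(ℝ, ℝ) (fun y => J y ξ) x v : ℝ)
  /-- `J (g x) = Ad^*_{g⁻¹} (J (x))`. -/
  equivariant : ∀ (g : G) (x : M) (ξ : GroupLieAlgebra IG G),
    J (Φ g x) ξ = J x (adjoint IG G g⁻¹ ξ)

end Actions

end Tulczyjew

end

open Tulczyjew

/-!
The Hamiltonian actions come from two facts about a smooth action `Φ` of `G` on a manifold `M`.

* The cotangent lift of `Φ` is Hamiltonian (`isHamiltonianAction_cotangentLift`). The Liouville form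
  `λ` is invariant and `λ (ξ_{T*M}) = J_ξ`, so that `i_ξ ω = - i_ξ dλ = d (i_ξ λ) = dJ_ξ`. Cartan's
  formula for an invariant one-form is the symmetry of the second derivative of the action map in
  charts (`vecExtDeriv_of_invariant`).
* If `Φ` is Hamiltonian for `(Ω, J)`, then `b_Ω : TM → T*M` is equivariant, and
  `J_{T*M} ∘ b_Ω = - dJ` because `Ω (v, ξ_M) = - dJ_ξ (v)`. As `Ω^c = - b_Ω^* ω_M`, the tangent lift
  is Hamiltonian for `Ω^c` with momentum map `dJ` (`IsHamiltonianAction.tangentLift`).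

The first fact for `TQ`, and the second for `T*Q` with its canonical form, give the two Hamiltonian actions.

In the charts induced by a chart of `Q`, the maps `b_ω` and `R` are the linear isomorphisms
`(q, p, δq, δp) ↦ (q, p, - δp dq + δq dp)` and `(q, v, a dq + b dv) ↦ (q, b, - a dq + v dp)`. The
second formula comes from the derivative `p δv + δp v` of the pairing: the terms in `δv` cancel
since `p = b`, and what is left is a function of the tangent vector `(δq, δp)` of `T*Q` alone, which
shows that `R` exists and is unique (`isRAt_iff_in_charts`). A map that reads a linear isomorphism
in corresponding charts over the base is a diffeomorphism
(`exists_diffeomorph_of_linear_in_charts`).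

The group acts on `T*Q ×_Q TQ` and leaves the pairing invariant. Differentiating the invariance at a
fixed group element shows that the equations for `R` are equivariant (`IsRAt.cotangentLift`);
differentiating along an orbit at the identity shows that the term `⟨W, W'⟩^T` vanishes on
generators, which is `J_{T*T*Q} ∘ R = - J_{T*TQ}` (`IsRAt.cotangentMomentum_eq`). Together with
`J_{T*T*Q} ∘ b_ω = - J_{TT*Q}`, this gives the assertions on `A_Q = R⁻¹ ∘ b_ω`.
-/

noncomputable section

namespace Tulczyjew

open Filter Set Topology

set_option linter.unusedSectionVars false

/-! ### Derivatives in preferred charts -/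

section Charts

variable {E : Type*} [NormedAddCommGroup E] [NormedSpace ℝ E]
  {H : Type*} [TopologicalSpace H] (I : ModelWithCorners ℝ E H)
  {M : Type*} [TopologicalSpace M] [ChartedSpace H M]
  {E' : Type*} [NormedAddCommGroup E'] [NormedSpace ℝ E']
  {H' : Type*} [TopologicalSpace H'] (I' : ModelWithCorners ℝ E' H')
  {N : Type*} [TopologicalSpace N] [ChartedSpace H' N]
  {E'' : Type*} [NormedAddCommGroup E''] [NormedSpace ℝ E'']
  {H'' : Type*} [TopologicalSpace H''] (I'' : ModelWithCorners ℝ E'' H'')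
  {P : Type*} [TopologicalSpace P] [ChartedSpace H'' P]

/-- The derivative of a map of manifolds, as a continuous linear map between the model vector
spaces. It is `mfderiv`, with every tangent space replaced by the vector space that it is by
definition; this keeps types of derivatives independent of base points. -/
def mder (f : M → N) (x : M) : E →L[ℝ] E' := mfderiv I I' f x

variable {I I' I''} in
theorem mder_comp {g : N → P} {f : M → N} {x : M} (hg : MDifferentiableAt I' I'' g (f x))
    (hf : MDifferentiableAt I I' f x) :
    mder I I'' (g ∘ f) x = mder I' I'' g (f x) ∘L mder I I' f x :=
  mfderiv_comp x hg hf

variable {I I'} in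
theorem mder_congr {f g : M → N} {x : M} (h : f =ᶠ[𝓝 x] g) :
    mder I I' f x = mder I I' g x := by
  have := h.mfderiv_eq (I := I) (I' := I')
  exact this

theorem mder_id (x : M) : mder I I (id : M → M) x = ContinuousLinearMap.id ℝ E :=
  mfderiv_id

theorem mder_vectorSpace {F : E → E'} {x : E} : mder 𝓘(ℝ, E) 𝓘(ℝ, E') F x = fderiv ℝ F x :=
  mfderiv_eq_fderiv

/-- The derivative at `x` of the preferred chart at `x₀`. -/
def chartDeriv (x₀ x : M) : E →L[ℝ] E := mder I 𝓘(ℝ, E) (extChartAt I x₀) x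

/-- The derivative at `y` of the inverse of the preferred chart at `x₀`. -/
def chartDerivSymm (x₀ : M) (y : E) : E →L[ℝ] E := mder 𝓘(ℝ, E) I (extChartAt I x₀).symm y

variable [I.Boundaryless] [IsManifold I ∞ M] [I'.Boundaryless] [IsManifold I' ∞ N]

variable {I I'}

theorem mdifferentiableAt_extChart {x₀ x : M} (hx : x ∈ (extChartAt I x₀).source) :
    MDifferentiableAt I 𝓘(ℝ, E) (extChartAt I x₀) x :=
  have : IsManifold I 1 M := .of_le (n := ∞) (by simp)
  mdifferentiableAt_extChartAt (by simpa using hx)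

theorem mdifferentiableAt_extChart_symm {x₀ : M} {y : E} (hy : y ∈ (extChartAt I x₀).target) :
    MDifferentiableAt 𝓘(ℝ, E) I (extChartAt I x₀).symm y := by
  have : IsManifold I 1 M := .of_le (n := ∞) (by simp)
  have := mdifferentiableWithinAt_extChartAt_symm (I := I) hy
  rwa [I.range_eq_univ, mdifferentiableWithinAt_univ] at this

theorem chartDeriv_comp_symm {x₀ x : M} (hx : x ∈ (extChartAt I x₀).source) :
    chartDeriv I x₀ x ∘L chartDerivSymm I x₀ (extChartAt I x₀ x) = ContinuousLinearMap.id ℝ E := by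
  have : IsManifold I 1 M := .of_le (n := ∞) (by simp)
  have := mfderiv_extChartAt_comp_mfderivWithin_extChartAt_symm' (I := I) hx
  rw [I.range_eq_univ, mfderivWithin_univ] at this
  exact this

theorem chartDerivSymm_comp {x₀ x : M} (hx : x ∈ (extChartAt I x₀).source) :
    chartDerivSymm I x₀ (extChartAt I x₀ x) ∘L chartDeriv I x₀ x = ContinuousLinearMap.id ℝ E := by
  have : IsManifold I 1 M := .of_le (n := ∞) (by simp)
  have := mfderivWithin_extChartAt_symm_comp_mfderiv_extChartAt' (I := I) hx
  rw [I.range_eq_univ, mfderivWithin_univ] at this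
  exact this

theorem chartDeriv_symm_apply {x₀ x : M} (hx : x ∈ (extChartAt I x₀).source) (v : E) :
    chartDeriv I x₀ x (chartDerivSymm I x₀ (extChartAt I x₀ x) v) = v :=
  DFunLike.congr_fun (chartDeriv_comp_symm hx) v

theorem chartDerivSymm_apply {x₀ x : M} (hx : x ∈ (extChartAt I x₀).source) (v : E) :
    chartDerivSymm I x₀ (extChartAt I x₀ x) (chartDeriv I x₀ x v) = v :=
  DFunLike.congr_fun (chartDerivSymm_comp hx) v

theorem chartDeriv_self (x : M) : chartDeriv I x x = ContinuousLinearMap.id ℝ E := by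
  have : IsManifold I 1 M := .of_le (n := ∞) (by simp)
  exact mfderiv_extChartAt_self

theorem chartDerivSymm_self (x : M) :
    chartDerivSymm I x (extChartAt I x x) = ContinuousLinearMap.id ℝ E := by
  have := chartDeriv_comp_symm (I := I) (mem_extChartAt_source (I := I) x)
  rwa [chartDeriv_self] at this

/-- If a map reads `F` in charts, its derivative reads the derivative of `F`. -/
theorem chartDeriv_comp_mder {f : M → N} {x x₀ : M} {z₀ : N} (hf : MDifferentiableAt I I' f x)
    (hx : x ∈ (extChartAt I x₀).source) (hz : f x ∈ (extChartAt I' z₀).source) {F : E → E'}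
    (hF : DifferentiableAt ℝ F (extChartAt I x₀ x))
    (h : ∀ᶠ y in 𝓝 x, extChartAt I' z₀ (f y) = F (extChartAt I x₀ y)) :
    chartDeriv I' z₀ (f x) ∘L mder I I' f x =
      fderiv ℝ F (extChartAt I x₀ x) ∘L chartDeriv I x₀ x := by
  have h1 : mder I 𝓘(ℝ, E') (extChartAt I' z₀ ∘ f) x = chartDeriv I' z₀ (f x) ∘L mder I I' f x :=
    mder_comp (mdifferentiableAt_extChart hz) hf
  have h2 : mder I 𝓘(ℝ, E') (F ∘ extChartAt I x₀) x =
      fderiv ℝ F (extChartAt I x₀ x) ∘L chartDeriv I x₀ x := by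
    rw [mder_comp hF.mdifferentiableAt (mdifferentiableAt_extChart hx), mder_vectorSpace]; rfl
  rw [← h1, ← h2]
  exact mder_congr h

/-- A covector at a point of `M`, as a linear functional on the model space. -/
def cov {x : M} (a : CotangentSpace I x) : E →L[ℝ] ℝ := a

/-! ### Preferred charts of the tangent and cotangent bundles -/

theorem extChartAt_tangent_source (v₀ : TangentBundle I M) :
    (extChartAt I.tangent v₀).source = (fun v => v.1) ⁻¹' (extChartAt I v₀.1).source := by
  ext v
  simp

theorem extChartAt_cotangent_source (α₀ : CotangentBundle I M) :
    (extChartAt (cotangentModel I) α₀).source = (fun v => v.1) ⁻¹' (extChartAt I α₀.1).source := by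
  ext v
  rw [FiberBundle.extChartAt]
  simp only [PartialEquiv.trans_source, PartialEquiv.prod_source, PartialEquiv.refl_source,
    mem_inter_iff, mem_preimage, mem_prod, mem_univ, and_true]
  refine ⟨fun h => h.2, fun h => ⟨?_, h⟩⟩
  simpa using h

theorem extChartAt_sum_source (α₀ : CotangentTangentBundle I M) :
    (extChartAt (cotangentTangentModel I) α₀).source =
      (fun v => v.1) ⁻¹' (extChartAt I α₀.1).source := by
  ext v
  rw [FiberBundle.extChartAt]
  simp only [PartialEquiv.trans_source, PartialEquiv.prod_source, PartialEquiv.refl_source,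
    mem_inter_iff, mem_preimage, mem_prod, mem_univ, and_true]
  refine ⟨fun h => h.2, fun h => ⟨?_, h⟩⟩
  simpa using h

theorem extChartAt_tangent_target (v₀ : TangentBundle I M) :
    (extChartAt I.tangent v₀).target = (extChartAt I v₀.1).target ×ˢ univ := by
  rw [FiberBundle.extChartAt_target]
  congr 1
  refine inter_eq_left.2 fun y hy => ?_
  simpa using (extChartAt I v₀.1).map_target hy

theorem extChartAt_cotangent_target (v₀ : CotangentBundle I M) :
    (extChartAt (cotangentModel I) v₀).target = (extChartAt I v₀.1).target ×ˢ univ := by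
  rw [FiberBundle.extChartAt_target]
  congr 1
  refine inter_eq_left.2 fun y hy => ?_
  simpa using (extChartAt I v₀.1).map_target hy

theorem extChartAt_tangent {v₀ v : TangentBundle I M} (h : v.1 ∈ (extChartAt I v₀.1).source) :
    extChartAt I.tangent v₀ v = (extChartAt I v₀.1 v.1, chartDeriv I v₀.1 v.1 v.2) := by
  have : IsManifold I 1 M := .of_le (n := ∞) (by simp)
  have h' : v.1 ∈ (chartAt H v₀.1).source := by simpa using h
  have := TangentBundle.continuousLinearMapAt_trivializationAt (I := I) h'
  rw [FiberBundle.extChartAt]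
  refine Prod.ext rfl ?_
  have h2 := DFunLike.congr_fun this v.2
  refine Eq.trans ?_ h2
  rw [Trivialization.continuousLinearMapAt_apply, Trivialization.coe_linearMapAt_of_mem]
  · rfl
  · exact h'

theorem extChartAt_cotangent {v₀ v : CotangentBundle I M} (h : v.1 ∈ (extChartAt I v₀.1).source) :
    extChartAt (cotangentModel I) v₀ v = (extChartAt I v₀.1 v.1,
      cov v.2 ∘L chartDerivSymm I v₀.1 (extChartAt I v₀.1 v.1)) := by
  have : IsManifold I 1 M := .of_le (n := ∞) (by simp)
  have h' : v.1 ∈ (chartAt H v₀.1).source := by simpa using h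
  have := TangentBundle.symmL_trivializationAt (I := I) h'
  rw [FiberBundle.extChartAt]
  refine Prod.ext rfl ?_
  change ContinuousLinearMap.inCoordinates E (TangentSpace I : M → Type _) ℝ (Trivial M ℝ)
    v₀.1 v.1 v₀.1 v.1 v.2 = _
  rw [ContinuousLinearMap.inCoordinates, this, I.range_eq_univ, mfderivWithin_univ]
  ext w
  simp
  rfl

theorem extChartAt_sum {v₀ v : CotangentTangentBundle I M}
    (h : v.1 ∈ (extChartAt I v₀.1).source) :
    extChartAt (cotangentTangentModel I) v₀ v = (extChartAt I v₀.1 v.1,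
      (cov v.2.1 ∘L chartDerivSymm I v₀.1 (extChartAt I v₀.1 v.1),
        chartDeriv I v₀.1 v.1 v.2.2)) := by
  have h1 := extChartAt_tangent (v₀ := ⟨v₀.1, v₀.2.2⟩) (v := ⟨v.1, v.2.2⟩) h
  have h2 := extChartAt_cotangent (v₀ := ⟨v₀.1, v₀.2.1⟩) (v := ⟨v.1, v.2.1⟩) h
  rw [FiberBundle.extChartAt] at h1 h2 ⊢
  refine Prod.ext rfl (Prod.ext ?_ ?_)
  · have h3 := congrArg Prod.snd h2
    exact h3
  · have h3 := congrArg Prod.snd h1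
    exact h3

end Charts

/-! ### Exterior derivatives of one-forms -/

section VectorSpace

variable {E : Type*} [NormedAddCommGroup E] [NormedSpace ℝ E]
  {E' : Type*} [NormedAddCommGroup E'] [NormedSpace ℝ E']

/-- The exterior derivative `(v, w) ↦ (D_v ϑ)(w) - (D_w ϑ)(v)` of a one-form on a vector space. -/
def vecExtDeriv (ϑ : E → E →L[ℝ] ℝ) (y v w : E) : ℝ :=
  fderiv ℝ ϑ y v w - fderiv ℝ ϑ y w v

/-- The exterior derivative commutes with pullbacks, because second derivatives are symmetric. -/
theorem vecExtDeriv_pullback {F : E → E'} {y : E} (hF : ContDiffAt ℝ ∞ F y)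
    {ϑ : E → E →L[ℝ] ℝ} {ϑ' : E' → E' →L[ℝ] ℝ} (hϑ' : DifferentiableAt ℝ ϑ' (F y))
    (h : ∀ᶠ z in 𝓝 y, ϑ z = ϑ' (F z) ∘L fderiv ℝ F z) :
    DifferentiableAt ℝ ϑ y ∧ ∀ v w, vecExtDeriv ϑ y v w =
      vecExtDeriv ϑ' (F y) (fderiv ℝ F y v) (fderiv ℝ F y w) := by
  have hd : HasFDerivAt (fun z => ϑ' (F z)) (fderiv ℝ ϑ' (F y) ∘L fderiv ℝ F y) y :=
    hϑ'.hasFDerivAt.comp y (hF.differentiableAt (by simp)).hasFDerivAt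
  have h2 : HasFDerivAt (fderiv ℝ F) (fderiv ℝ (fderiv ℝ F) y) y :=
    ((hF.fderiv_right (m := 1) (by norm_cast)).differentiableAt (by simp)).hasFDerivAt
  have key := (hd.clm_comp h2).congr_of_eventuallyEq h
  have hsymm : IsSymmSndFDerivAt ℝ F y := hF.isSymmSndFDerivAt (by simp; norm_cast)
  refine ⟨key.differentiableAt, fun v w => ?_⟩
  have hvw := hsymm.eq v w
  simp only [vecExtDeriv, key.fderiv]
  simp [hvw]

/-- The infinitesimal form of the invariance of a one-form `ϑ` under a family `F (s, ·)` of maps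
with `F (s₀, ·) = id`: with `X = ∂F/∂s` at `s₀`, one has `i_X dϑ = - d (ϑ X)`. -/
theorem vecExtDeriv_of_invariant {F : E' × E → E} {s₀ : E'} {y₀ : E}
    (hF : ContDiffAt ℝ ∞ F (s₀, y₀)) (hid : ∀ᶠ y in 𝓝 y₀, F (s₀, y) = y)
    {ϑ : E → E →L[ℝ] ℝ} (hϑ : DifferentiableAt ℝ ϑ y₀)
    (h : ∀ᶠ s in 𝓝 s₀, ϑ (F (s, y₀)) ∘L fderiv ℝ F (s, y₀) ∘L .inr ℝ E' E = ϑ y₀) (ξ : E') :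
    DifferentiableAt ℝ (fun y => ϑ y (fderiv ℝ F (s₀, y) (ξ, 0))) y₀ ∧
    ∀ v, vecExtDeriv ϑ y₀ (fderiv ℝ F (s₀, y₀) (ξ, 0)) v =
      - fderiv ℝ (fun y => ϑ y (fderiv ℝ F (s₀, y) (ξ, 0))) y₀ v := by
  have h0 : F (s₀, y₀) = y₀ := hid.self_of_nhds
  set D := fderiv ℝ F (s₀, y₀) with hD
  have hd : HasFDerivAt F D (s₀, y₀) := (hF.differentiableAt (by simp)).hasFDerivAt
  have h2 : HasFDerivAt (fderiv ℝ F) (fderiv ℝ (fderiv ℝ F) (s₀, y₀)) (s₀, y₀) :=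
    ((hF.fderiv_right (m := 1) (by norm_cast)).differentiableAt (by simp)).hasFDerivAt
  have hsymm : IsSymmSndFDerivAt ℝ F (s₀, y₀) := hF.isSymmSndFDerivAt (by simp; norm_cast)
  have hl : HasFDerivAt (fun s : E' => (s, y₀)) (.inl ℝ E' E) s₀ := hasFDerivAt_prodMk_left s₀ y₀
  have hr : HasFDerivAt (fun y : E => (s₀, y)) (.inr ℝ E' E) y₀ := hasFDerivAt_prodMk_right s₀ y₀
  have hDr : D ∘L .inr ℝ E' E = .id ℝ E :=
    ((hd.comp y₀ hr).congr_of_eventuallyEq (hid.mono fun y hy => hy.symm)).unique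
      (hasFDerivAt_id y₀)
  have h3 : HasFDerivAt (fun s => fderiv ℝ F (s, y₀)) _ s₀ :=
    HasFDerivAt.comp (f := fun s => (s, y₀)) s₀ h2 hl
  have h4 : HasFDerivAt (fun y => fderiv ℝ F (s₀, y)) _ y₀ :=
    HasFDerivAt.comp (f := fun y => (s₀, y)) y₀ h2 hr
  have hϑ' : HasFDerivAt (fun s => ϑ (F (s, y₀))) (fderiv ℝ ϑ y₀ ∘L (D ∘L .inl ℝ E' E)) s₀ := by
    have h : HasFDerivAt ϑ (fderiv ℝ ϑ y₀) (F (s₀, y₀)) := by rw [h0]; exact hϑ.hasFDerivAt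
    exact HasFDerivAt.comp (f := fun s => F (s, y₀)) s₀ h
      (HasFDerivAt.comp (f := fun s => (s, y₀)) s₀ hd hl)
  have h6 : HasFDerivAt (fun y => ϑ y (fderiv ℝ F (s₀, y) (ξ, 0))) _ y₀ :=
    hϑ.hasFDerivAt.clm_apply (h4.clm_apply (hasFDerivAt_const ((ξ, 0) : E' × E) y₀))
  refine ⟨h6.differentiableAt, fun v => ?_⟩
  -- the derivative of the invariance condition in the direction `ξ`
  have h5 : HasFDerivAt (fun s => ϑ (F (s, y₀)) (fderiv ℝ F (s, y₀) (0, v))) _ s₀ :=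
    hϑ'.clm_apply (h3.clm_apply (hasFDerivAt_const ((0, v) : E' × E) s₀))
  have h5' : HasFDerivAt (fun s => ϑ (F (s, y₀)) (fderiv ℝ F (s, y₀) (0, v))) 0 s₀ :=
    (hasFDerivAt_const (𝕜 := ℝ) (ϑ y₀ v) s₀).congr_of_eventuallyEq (h.mono fun s hs => by
      rw [← hs]; rfl)
  have h7 := DFunLike.congr_fun (h5.unique h5') ξ
  have h8 : D (0, v) = v := DFunLike.congr_fun hDr v
  have h9 := hsymm.eq (ξ, 0) (0, v)
  have h10 := congrArg (fun L : E →L[ℝ] ℝ => - L v) h6.fderiv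
  refine Eq.trans ?_ h10.symm
  simp [h0, ← hD, h8] at h7 ⊢
  rw [h9] at h7
  simp only [vecExtDeriv]
  linarith

end VectorSpace

section Manifold

variable {E : Type*} [NormedAddCommGroup E] [NormedSpace ℝ E]
  {H : Type*} [TopologicalSpace H] {I : ModelWithCorners ℝ E H}
  {M : Type*} [TopologicalSpace M] [ChartedSpace H M]
  {E' : Type*} [NormedAddCommGroup E'] [NormedSpace ℝ E']
  {H' : Type*} [TopologicalSpace H'] {I' : ModelWithCorners ℝ E' H'}
  {N : Type*} [TopologicalSpace N] [ChartedSpace H' N]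
  [I.Boundaryless] [IsManifold I ∞ M] [I'.Boundaryless] [IsManifold I' ∞ N]

theorem oneFormInChart_eq (θ : ∀ x : M, CotangentSpace I x) (x₀ : M) (y : E) :
    oneFormInChart I θ x₀ y = cov (θ ((extChartAt I x₀).symm y)) ∘L chartDerivSymm I x₀ y :=
  rfl

/-- The exterior derivative of a one-form at `x`, computed in the preferred chart at `x₀`. -/
def extDerivIn (θ : ∀ x : M, CotangentSpace I x) (x₀ x : M) (v w : E) : ℝ :=
  vecExtDeriv (oneFormInChart I θ x₀) (extChartAt I x₀ x)
    (chartDeriv I x₀ x v) (chartDeriv I x₀ x w)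

/-- The expression in charts of a map of manifolds. -/
def inCharts (I : ModelWithCorners ℝ E H) (I' : ModelWithCorners ℝ E' H') (x₀ : M) (z₀ : N)
    (f : M → N) (y : E) : E' :=
  extChartAt I' z₀ (f ((extChartAt I x₀).symm y))

theorem eventually_mem_source {x₀ x : M} (hx : x ∈ (extChartAt I x₀).source) :
    ∀ᶠ y in 𝓝 x, y ∈ (extChartAt I x₀).source :=
  (isOpen_extChartAt_source x₀).mem_nhds hx

theorem eventually_mem_target {x₀ x : M} (hx : x ∈ (extChartAt I x₀).source) :
    ∀ᶠ y in 𝓝 (extChartAt I x₀ x), y ∈ (extChartAt I x₀).target :=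
  (isOpen_extChartAt_target x₀).mem_nhds ((extChartAt I x₀).map_source hx)

theorem eventually_chart_symm {x₀ x : M} (hx : x ∈ (extChartAt I x₀).source) {p : M → Prop}
    (hp : ∀ᶠ y in 𝓝 x, p y) : ∀ᶠ y in 𝓝 (extChartAt I x₀ x), p ((extChartAt I x₀).symm y) := by
  have h : Tendsto (extChartAt I x₀).symm (𝓝 (extChartAt I x₀ x)) (𝓝 x) := by
    have := continuousAt_extChartAt_symm' (I := I) hx
    rwa [ContinuousAt, (extChartAt I x₀).left_inv hx] at this
  exact h.eventually hp

theorem contMDiffAt_chart_symm {x₀ x : M} (hx : x ∈ (extChartAt I x₀).source) :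
    ContMDiffAt 𝓘(ℝ, E) I ∞ (extChartAt I x₀).symm (extChartAt I x₀ x) :=
  (contMDiffOn_extChartAt_symm x₀).contMDiffAt
    ((isOpen_extChartAt_target x₀).mem_nhds ((extChartAt I x₀).map_source hx))

theorem contDiffAt_inCharts {f : M → N} {x x₀ : M} {z₀ : N} (hf : ContMDiffAt I I' ∞ f x)
    (hx : x ∈ (extChartAt I x₀).source) (hz : f x ∈ (extChartAt I' z₀).source) :
    ContDiffAt ℝ ∞ (inCharts I I' x₀ z₀ f) (extChartAt I x₀ x) := by
  have h1 := contMDiffAt_chart_symm hx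
  have h2 := (extChartAt I x₀).left_inv hx
  have h3 : ContMDiffAt I 𝓘(ℝ, E') ∞ (extChartAt I' z₀ ∘ f) x :=
    (contMDiffAt_extChartAt' (by simpa using hz)).comp x hf
  have h4 : ContMDiffAt I 𝓘(ℝ, E') ∞ (extChartAt I' z₀ ∘ f)
    ((extChartAt I x₀).symm (extChartAt I x₀ x)) := by rwa [h2]
  exact (h4.comp _ h1).contDiffAt

theorem fderiv_inCharts {f : M → N} {x x₀ : M} {z₀ : N} (hf : MDifferentiableAt I I' f x)
    (hx : x ∈ (extChartAt I x₀).source) (hz : f x ∈ (extChartAt I' z₀).source) :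
    fderiv ℝ (inCharts I I' x₀ z₀ f) (extChartAt I x₀ x) =
      chartDeriv I' z₀ (f x) ∘L mder I I' f x ∘L chartDerivSymm I x₀ (extChartAt I x₀ x) := by
  have h1 := mdifferentiableAt_extChart_symm ((extChartAt I x₀).map_source hx)
  have h2 := (extChartAt I x₀).left_inv hx
  have h3 : MDifferentiableAt I 𝓘(ℝ, E') (extChartAt I' z₀ ∘ f) x :=
    (mdifferentiableAt_extChart hz).comp x hf
  rw [← mder_vectorSpace]
  have h4 : MDifferentiableAt I 𝓘(ℝ, E') (extChartAt I' z₀ ∘ f)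
    ((extChartAt I x₀).symm (extChartAt I x₀ x)) := by rwa [h2]
  refine (mder_comp h4 h1).trans ?_
  rw [h2, mder_comp (mdifferentiableAt_extChart hz) hf]
  rfl

theorem cov_eq_of_eq {θ : ∀ x : M, CotangentSpace I x} {x y : M} (h : x = y) :
    cov (θ x) = cov (θ y) := by rw [h]

/-- The exterior derivative of one-forms commutes with pullbacks. The derivatives may be computed
in any charts; for the identity map, this is their independence of the chart. -/
theorem extDerivIn_pullback {f : M → N} {x x₀ : M} {z₀ : N}
    (hf : ∀ᶠ y in 𝓝 x, ContMDiffAt I I' ∞ f y)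
    (hx : x ∈ (extChartAt I x₀).source) (hz : f x ∈ (extChartAt I' z₀).source)
    {η : ∀ x : M, CotangentSpace I x} {θ : ∀ x : N, CotangentSpace I' x}
    (hθ : DifferentiableAt ℝ (oneFormInChart I' θ z₀) (extChartAt I' z₀ (f x)))
    (h : ∀ᶠ y in 𝓝 x, cov (η y) = cov (θ (f y)) ∘L mder I I' f y) :
    DifferentiableAt ℝ (oneFormInChart I η x₀) (extChartAt I x₀ x) ∧ ∀ v w : E,
    extDerivIn η x₀ x v w = extDerivIn θ z₀ (f x) (mder I I' f x v) (mder I I' f x w) := by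
  have hfx := hf.self_of_nhds
  have hl := (extChartAt I x₀).left_inv hx
  have hF : inCharts I I' x₀ z₀ f (extChartAt I x₀ x) = extChartAt I' z₀ (f x) := by
    rw [inCharts, hl]
  have hev : ∀ᶠ y in 𝓝 (extChartAt I x₀ x), oneFormInChart I η x₀ y =
      oneFormInChart I' θ z₀ (inCharts I I' x₀ z₀ f y) ∘L
        fderiv ℝ (inCharts I I' x₀ z₀ f) y := by
    have h5 := hfx.continuousAt.eventually (eventually_mem_source (I := I') hz)
    filter_upwards [eventually_chart_symm hx h, eventually_chart_symm hx h5,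
      eventually_chart_symm hx hf, eventually_mem_target hx] with y h1 h2 h3 h4
    have h6 := fderiv_inCharts (h3.mdifferentiableAt (by simp)) ((extChartAt I x₀).map_target h4) h2
    rw [(extChartAt I x₀).right_inv h4] at h6
    rw [h6, oneFormInChart_eq, oneFormInChart_eq, h1, inCharts]
    rw [cov_eq_of_eq (θ := θ) ((extChartAt I' z₀).left_inv h2)]
    ext v
    have h8 := chartDerivSymm_apply h2
    simp only [ContinuousLinearMap.comp_apply, h8]
  have hpull := vecExtDeriv_pullback (contDiffAt_inCharts hfx hx hz) (by rwa [hF]) hev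
  refine ⟨hpull.1, fun v w => ?_⟩
  have h9 := fderiv_inCharts (hfx.mdifferentiableAt (by simp)) hx hz
  rw [extDerivIn, hpull.2, hF, h9, extDerivIn]
  simp only [ContinuousLinearMap.comp_apply, chartDerivSymm_apply hx]

/-- The exterior derivative of a one-form, computed in any chart. -/
theorem oneFormExtDeriv_eq_extDerivIn {θ : ∀ x : M, CotangentSpace I x} {x x₀ : M}
    (hx : x ∈ (extChartAt I x₀).source)
    (hθ : DifferentiableAt ℝ (oneFormInChart I θ x₀) (extChartAt I x₀ x))
    (v w : TangentSpace I x) : oneFormExtDeriv I θ x v w = extDerivIn θ x₀ x v w := by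
  have := (extDerivIn_pullback (f := (id : M → M)) (x₀ := x) (η := θ)
    (Eventually.of_forall fun y => contMDiffAt_id)
    (mem_extChartAt_source x) hx hθ (Eventually.of_forall fun y => by rw [mder_id]; rfl)).2 v w
  rw [mder_id] at this
  exact this

variable {EG : Type*} [NormedAddCommGroup EG] [NormedSpace ℝ EG]
  {HG : Type*} [TopologicalSpace HG] {IG : ModelWithCorners ℝ EG HG} [IG.Boundaryless]
  {G : Type*} [TopologicalSpace G] [ChartedSpace HG G] [IsManifold IG ∞ G] [Group G]

/-- `i_{ξ_M} dθ = - d (θ (ξ_M))` for a one-form `θ` that is invariant under a smooth action. -/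
theorem oneFormExtDeriv_generator {Φ : G → M → M} (h1 : ∀ x, Φ 1 x = x)
    (hΦ : ContMDiff (IG.prod I) I ∞ (fun p : G × M => Φ p.1 p.2))
    {θ : ∀ x : M, CotangentSpace I x} {x : M}
    (hθ : DifferentiableAt ℝ (oneFormInChart I θ x) (extChartAt I x x))
    (hinv : ∀ g y, cov (θ (Φ g y)) ∘L mder I I (Φ g) y = cov (θ y))
    (ξ : EG) (v : E) :
    extDerivIn θ x x (mder IG I (fun g => Φ g x) 1 ξ) v =
      - mder I 𝓘(ℝ, ℝ) (fun y => cov (θ y) (mder IG I (fun g => Φ g y) 1 ξ)) x v := by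
  have hx := mem_extChartAt_source (I := I) x
  have hG := mem_extChartAt_source (I := IG) (1 : G)
  have hpx : (1, x) ∈ (extChartAt (IG.prod I) ((1, x) : G × M)).source := mem_extChartAt_source _
  set s₀ := extChartAt IG (1 : G) 1 with hs₀
  set y₀ := extChartAt I x x with hy₀
  set F : EG × E → E :=
    inCharts (IG.prod I) I ((1, x) : G × M) x (fun p : G × M => Φ p.1 p.2) with hF
  have hΦx : Φ 1 x ∈ (extChartAt I x).source := by rw [h1]; exact hx
  have hsm : ContDiffAt ℝ ∞ F (s₀, y₀) := by
    have := contDiffAt_inCharts (hΦ (1, x)) hpx hΦx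
    rwa [extChartAt_prod] at this
  have hFe : ∀ s y, F (s, y) = inCharts I I x x (Φ ((extChartAt IG 1).symm s)) y := by
    intro s y; simp only [hF, inCharts, extChartAt_prod]; rfl
  have hFe' : ∀ s y, F (s, y) =
      inCharts IG I 1 x (fun g => Φ g ((extChartAt I x).symm y)) s := by
    intro s y; simp only [hF, inCharts, extChartAt_prod]; rfl
  have hsymm1 : (extChartAt IG (1 : G)).symm s₀ = 1 := (extChartAt IG (1 : G)).left_inv hG
  have hsymmx : (extChartAt I x).symm y₀ = x := (extChartAt I x).left_inv hx
  have hid : ∀ᶠ y in 𝓝 y₀, F (s₀, y) = y := by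
    filter_upwards [eventually_mem_target hx] with y hy
    rw [hFe, inCharts, hsymm1, h1, (extChartAt I x).right_inv hy]
  have hΦg : ∀ g, ContMDiff I I ∞ (Φ g) := fun g =>
    hΦ.comp (contMDiff_const.prodMk contMDiff_id)
  have hΦy : ∀ y, ContMDiff IG I ∞ (fun g => Φ g y) := fun y =>
    hΦ.comp (contMDiff_id.prodMk contMDiff_const)
  have hcont : ∀ᶠ p in 𝓝 (s₀, y₀), DifferentiableAt ℝ F p := by
    have := (hsm.of_le (m := 1) (by norm_cast)).eventually (by simp)
    exact this.mono fun p hp => hp.differentiableAt (by simp)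
  have hcont1 : ∀ᶠ s in 𝓝 s₀, DifferentiableAt ℝ F (s, y₀) :=
    (Continuous.tendsto (f := fun s : EG => (s, y₀)) (by fun_prop) s₀).eventually hcont
  have hcont2 : ∀ᶠ y in 𝓝 y₀, DifferentiableAt ℝ F (s₀, y) :=
    (Continuous.tendsto (f := fun y : E => (s₀, y)) (by fun_prop) y₀).eventually hcont
  have hinv' : ∀ᶠ s in 𝓝 s₀, oneFormInChart I θ x (F (s, y₀)) ∘L fderiv ℝ F (s, y₀) ∘L
      .inr ℝ EG E = oneFormInChart I θ x y₀ := by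
    have hc : ∀ᶠ g in 𝓝 (1 : G), Φ g x ∈ (extChartAt I x).source :=
      (hΦy x).continuous.continuousAt.eventually (eventually_mem_source (I := I) hΦx)
    filter_upwards [hcont1, eventually_chart_symm hG hc] with s hs hs'
    have e1 : fderiv ℝ F (s, y₀) ∘L .inr ℝ EG E =
        fderiv ℝ (inCharts I I x x (Φ ((extChartAt IG 1).symm s))) y₀ := by
      refine (HasFDerivAt.fderiv ?_).symm
      have := hs.hasFDerivAt.comp y₀ (hasFDerivAt_prodMk_right s y₀)
      exact this.congr_of_eventuallyEq (Eventually.of_forall fun y => (hFe s y).symm)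
    rw [e1, fderiv_inCharts ((hΦg _).mdifferentiable (by simp) x) hx hs', hFe, inCharts, hsymmx,
      oneFormInChart_eq, oneFormInChart_eq, cov_eq_of_eq (θ := θ) ((extChartAt I x).left_inv hs'),
      cov_eq_of_eq (θ := θ) hsymmx, ← hinv ((extChartAt IG 1).symm s) x]
    ext w
    simp only [ContinuousLinearMap.comp_apply, chartDerivSymm_apply hs']
    rw [← hy₀]
  obtain ⟨hdiff, key⟩ := vecExtDeriv_of_invariant hsm hid hθ hinv' ξ
  -- the partial derivative of `F` along `G` is the generator
  have hgen : ∀ᶠ y in 𝓝 y₀, fderiv ℝ F (s₀, y) (ξ, 0) =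
      chartDeriv I x ((extChartAt I x).symm y)
        (mder IG I (fun g => Φ g ((extChartAt I x).symm y)) 1 ξ) := by
    filter_upwards [hcont2, eventually_mem_target hx] with y hy hy'
    have hsrc := (extChartAt I x).map_target hy'
    have e1 : fderiv ℝ F (s₀, y) ∘L .inl ℝ EG E =
        fderiv ℝ (inCharts IG I 1 x (fun g => Φ g ((extChartAt I x).symm y))) s₀ := by
      refine (HasFDerivAt.fderiv ?_).symm
      have := HasFDerivAt.comp (f := fun s => (s, y)) s₀ hy.hasFDerivAt
        (hasFDerivAt_prodMk_left s₀ y)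
      exact this.congr_of_eventuallyEq (Eventually.of_forall fun s => (hFe' s y).symm)
    have e2 := DFunLike.congr_fun e1 ξ
    rw [fderiv_inCharts ((hΦy _).mdifferentiable (by simp) 1) hG (by rwa [h1]),
      chartDerivSymm_self, h1] at e2
    exact e2
  have hJ : ∀ᶠ y in 𝓝 y₀, (oneFormInChart I θ x y) (fderiv ℝ F (s₀, y) (ξ, 0)) =
      (fun y => cov (θ y) (mder IG I (fun g => Φ g y) 1 ξ)) ((extChartAt I x).symm y) := by
    filter_upwards [hgen, eventually_mem_target hx] with y hy hy'
    have hsrc := (extChartAt I x).map_target hy'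
    have e3 := chartDerivSymm_apply hsrc
    rw [(extChartAt I x).right_inv hy'] at e3
    rw [hy, oneFormInChart_eq, ContinuousLinearMap.comp_apply, e3]
  have hJ' : ∀ᶠ z in 𝓝 x, cov (θ z) (mder IG I (fun g => Φ g z) 1 ξ) =
      (oneFormInChart I θ x (extChartAt I x z)) (fderiv ℝ F (s₀, extChartAt I x z) (ξ, 0)) := by
    have := (continuousAt_extChartAt (I := I) x).eventually hJ
    filter_upwards [this, eventually_mem_source hx] with z hz hz'
    rw [hz, (extChartAt I x).left_inv hz']
  have e4 : mder I 𝓘(ℝ, ℝ) (fun y => cov (θ y) (mder IG I (fun g => Φ g y) 1 ξ)) x =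
      fderiv ℝ (fun y => oneFormInChart I θ x y (fderiv ℝ F (s₀, y) (ξ, 0))) y₀ := by
    rw [mder_congr hJ']
    refine (mder_comp (I' := 𝓘(ℝ, E)) (f := extChartAt I x) (x := x)
      (g := fun y => oneFormInChart I θ x y (fderiv ℝ F (s₀, y) (ξ, 0)))
      hdiff.mdifferentiableAt (mdifferentiableAt_extChart hx)).trans ?_
    have := chartDeriv_self (I := I) x
    rw [chartDeriv] at this
    rw [this, mder_vectorSpace]
    rfl
  rw [e4, ← key, extDerivIn, hgen.self_of_nhds, hsymmx, chartDeriv_self]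
  rfl

end Manifold

section Smoothness

variable {E : Type*} [NormedAddCommGroup E] [NormedSpace ℝ E]
  {H : Type*} [TopologicalSpace H] {I : ModelWithCorners ℝ E H}
  {M : Type*} [TopologicalSpace M] [ChartedSpace H M]
  {E' : Type*} [NormedAddCommGroup E'] [NormedSpace ℝ E']
  {H' : Type*} [TopologicalSpace H'] {I' : ModelWithCorners ℝ E' H'}
  {N : Type*} [TopologicalSpace N] [ChartedSpace H' N]
  {E'' : Type*} [NormedAddCommGroup E''] [NormedSpace ℝ E'']
  {H'' : Type*} [TopologicalSpace H''] {I'' : ModelWithCorners ℝ E'' H''}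
  {P : Type*} [TopologicalSpace P] [ChartedSpace H'' P]
  [I.Boundaryless] [IsManifold I ∞ M] [I'.Boundaryless] [IsManifold I' ∞ N]

/-! ### Smooth maps into tangent and cotangent bundles -/

theorem cotangent_ext {α β : CotangentBundle I M} (h : α.1 = β.1) (h' : cov α.2 = cov β.2) :
    α = β := by
  obtain ⟨x, a⟩ := α
  obtain ⟨y, b⟩ := β
  obtain rfl : x = y := h
  exact congrArg (TotalSpace.mk x) h'

theorem tangent_ext {v w : TangentBundle I M} (h : v.1 = w.1) (h' : (v.2 : E) = w.2) : v = w := by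
  obtain ⟨x, a⟩ := v
  obtain ⟨y, b⟩ := w
  obtain rfl : x = y := h
  exact congrArg (TotalSpace.mk x) h'

/-- A map into `TM` is smooth iff its base point and its fibre component in a chart are smooth. -/
theorem contMDiffAt_tangent_iff {f : P → TangentBundle I M} {z₀ : P} {x₀ : M}
    (h₀ : (f z₀).1 ∈ (extChartAt I x₀).source) :
    ContMDiffAt I'' I.tangent ∞ f z₀ ↔ ContMDiffAt I'' I ∞ (fun z => (f z).1) z₀ ∧
      ContMDiffAt I'' 𝓘(ℝ, E) ∞ (fun z => chartDeriv I x₀ (f z).1 (f z).2) z₀ := by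
  have hb : (f z₀).1 ∈ (trivializationAt E (TangentSpace I) x₀).baseSet := by simpa using h₀
  have := Trivialization.contMDiffAt_iff (IM := I'') (IB := I) (n := ∞) (f := f) (x₀ := z₀)
    (e := trivializationAt E (TangentSpace I) x₀) ((Trivialization.mem_source _).2 hb)
  refine this.trans (and_congr_right fun h1 => ?_)
  refine Filter.EventuallyEq.contMDiffAt_iff ?_
  filter_upwards [h1.continuousAt.eventually (eventually_mem_source h₀)] with z hz
  have := extChartAt_tangent (v₀ := ⟨x₀, 0⟩) (v := f z) hz
  rw [FiberBundle.extChartAt] at this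
  have h3 := congrArg Prod.snd this
  exact h3

/-- A map into `T*M` is smooth iff its base point and its fibre component in a chart are smooth. -/
theorem contMDiffAt_cotangent_iff {f : P → CotangentBundle I M} {z₀ : P} {x₀ : M}
    (h₀ : (f z₀).1 ∈ (extChartAt I x₀).source) :
    ContMDiffAt I'' (cotangentModel I) ∞ f z₀ ↔ ContMDiffAt I'' I ∞ (fun z => (f z).1) z₀ ∧
      ContMDiffAt I'' 𝓘(ℝ, E →L[ℝ] ℝ) ∞
        (fun z => cov (f z).2 ∘L chartDerivSymm I x₀ (extChartAt I x₀ (f z).1)) z₀ := by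
  have hb : (f z₀).1 ∈
      (trivializationAt (E →L[ℝ] ℝ) (fun x : M => CotangentSpace I x) x₀).baseSet := by
    rw [hom_trivializationAt_baseSet]; simpa using h₀
  have := Trivialization.contMDiffAt_iff (IM := I'') (IB := I) (n := ∞) (f := f) (x₀ := z₀)
    (e := trivializationAt (E →L[ℝ] ℝ) (fun x : M => CotangentSpace I x) x₀)
    ((Trivialization.mem_source _).2 hb)
  refine this.trans (and_congr_right fun h1 => ?_)
  refine Filter.EventuallyEq.contMDiffAt_iff ?_
  filter_upwards [h1.continuousAt.eventually (eventually_mem_source h₀)] with z hz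
  have := extChartAt_cotangent (v₀ := ⟨x₀, 0⟩) (v := f z) hz
  rw [FiberBundle.extChartAt] at this
  have h3 := congrArg Prod.snd this
  exact h3

/-- Derivatives of a smooth family of maps, read in charts, depend smoothly on the parameter. -/
theorem contMDiffAt_mder [IsManifold I'' ∞ P] {f : P → M → N} {g : P → M} {z₀ : P} {x₀ : M} {y₀ : N}
    (hf : ContMDiffAt (I''.prod I) I' ∞ (fun p : P × M => f p.1 p.2) (z₀, g z₀))
    (hg : ContMDiffAt I'' I ∞ g z₀) (hx : g z₀ = x₀) (hy : f z₀ (g z₀) = y₀) :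
    ContMDiffAt I'' 𝓘(ℝ, E →L[ℝ] E') ∞ (fun z => chartDeriv I' y₀ (f z (g z)) ∘L
      mder I I' (f z) (g z) ∘L chartDerivSymm I x₀ (extChartAt I x₀ (g z))) z₀ := by
  subst hx hy
  have : IsManifold I 1 M := .of_le (n := ∞) (by simp)
  have : IsManifold I' 1 N := .of_le (n := ∞) (by simp)
  have : IsManifold I'' 1 P := .of_le (n := ∞) (by simp)
  have h1 := ContMDiffAt.mfderiv (m := ∞) f g hf hg (by simp)
  refine h1.congr_of_eventuallyEq ?_
  have hc : ContinuousAt (fun z => f z (g z)) z₀ :=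
    ContinuousAt.comp (f := fun z => (z, g z)) (g := fun p : P × M => f p.1 p.2)
      hf.continuousAt (continuousAt_id.prodMk hg.continuousAt)
  filter_upwards [hg.continuousAt.eventually
      (eventually_mem_source (I := I) (mem_extChartAt_source _)),
    hc.eventually (eventually_mem_source (I := I') (mem_extChartAt_source _))] with z h2 h3
  have e1 := TangentBundle.continuousLinearMapAt_trivializationAt (I := I') (x₀ := f z₀ (g z₀))
    (x := f z (g z)) (by simpa using h3)
  have e2 := TangentBundle.symmL_trivializationAt (I := I) (x₀ := g z₀)
    (x := g z) (by simpa using h2)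
  rw [I.range_eq_univ, mfderivWithin_univ] at e2
  change _ = ContinuousLinearMap.comp _ (ContinuousLinearMap.comp _ _)
  rw [e1, e2]
  rfl

theorem contMDiff_proj_cotangent :
    ContMDiff (cotangentModel I) I ∞ (fun α : CotangentBundle I M => α.1) :=
  contMDiff_proj _

theorem contMDiff_proj_tangent : ContMDiff I.tangent I ∞ (fun α : TangentBundle I M => α.1) :=
  contMDiff_proj _

end Smoothness

section Lifts

variable {EG : Type*} [NormedAddCommGroup EG] [NormedSpace ℝ EG]
  {HG : Type*} [TopologicalSpace HG] {IG : ModelWithCorners ℝ EG HG} [IG.Boundaryless]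
  {G : Type*} [TopologicalSpace G] [ChartedSpace HG G] [Group G] [LieGroup IG ∞ G]
  {E : Type*} [NormedAddCommGroup E] [NormedSpace ℝ E]
  {H : Type*} [TopologicalSpace H] {I : ModelWithCorners ℝ E H} [I.Boundaryless]
  {M : Type*} [TopologicalSpace M] [ChartedSpace H M] [IsManifold I ∞ M]

/-! ### Smooth actions and their lifts -/

variable (IG I) in
/-- The family `Φ` of maps is a smooth action of the group `G` on `M`. -/
structure IsSmoothAction (Φ : G → M → M) : Prop where
  one_act : ∀ x, Φ 1 x = x
  mul_act : ∀ g h x, Φ (g * h) x = Φ g (Φ h x)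
  contMDiff_act : ContMDiff (IG.prod I) I ∞ (fun p : G × M => Φ p.1 p.2)

variable {Φ : G → M → M}

theorem IsSmoothAction.inv_act (hΦ : IsSmoothAction IG I Φ) (g : G) (x : M) :
    Φ g⁻¹ (Φ g x) = x := by
  rw [← hΦ.mul_act, inv_mul_cancel, hΦ.one_act]

theorem IsSmoothAction.contMDiff (hΦ : IsSmoothAction IG I Φ) (g : G) : ContMDiff I I ∞ (Φ g) :=
  hΦ.contMDiff_act.comp (contMDiff_const.prodMk contMDiff_id)

theorem IsSmoothAction.contMDiff_orbit (hΦ : IsSmoothAction IG I Φ) (x : M) :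
    ContMDiff IG I ∞ (fun g => Φ g x) :=
  hΦ.contMDiff_act.comp (contMDiff_id.prodMk contMDiff_const)

theorem IsSmoothAction.mdifferentiable (hΦ : IsSmoothAction IG I Φ) (g : G) :
    MDifferentiable I I (Φ g) :=
  (hΦ.contMDiff g).mdifferentiable (by simp)

theorem IsSmoothAction.mder_one (hΦ : IsSmoothAction IG I Φ) (x : M) :
    mder I I (Φ 1) x = .id ℝ E := by
  have : Φ 1 = id := funext hΦ.one_act
  rw [this, mder_id]

theorem IsSmoothAction.mder_mul (hΦ : IsSmoothAction IG I Φ) (g h : G) (x : M) :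
    mder I I (Φ (g * h)) x = mder I I (Φ g) (Φ h x) ∘L mder I I (Φ h) x := by
  have : Φ (g * h) = Φ g ∘ Φ h := funext (hΦ.mul_act g h)
  rw [this, mder_comp (hΦ.mdifferentiable _ _) (hΦ.mdifferentiable _ _)]

theorem IsSmoothAction.mder_inv_comp (hΦ : IsSmoothAction IG I Φ) (g : G) (x : M) :
    mder I I (Φ g⁻¹) (Φ g x) ∘L mder I I (Φ g) x = .id ℝ E := by
  rw [← hΦ.mder_mul, inv_mul_cancel, hΦ.mder_one]

theorem IsSmoothAction.mder_comp_inv (hΦ : IsSmoothAction IG I Φ) (g : G) (x : M) :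
    mder I I (Φ g) x ∘L mder I I (Φ g⁻¹) (Φ g x) = .id ℝ E := by
  have h := hΦ.mder_mul g g⁻¹ (Φ g x)
  rw [hΦ.inv_act, mul_inv_cancel, hΦ.mder_one] at h
  exact h.symm

/-- An equivariant map relates infinitesimal generators. -/
theorem IsSmoothAction.mder_generator (hΦ : IsSmoothAction IG I Φ)
    {E' : Type*} [NormedAddCommGroup E'] [NormedSpace ℝ E'] {H' : Type*} [TopologicalSpace H']
    {I' : ModelWithCorners ℝ E' H'} {N : Type*} [TopologicalSpace N] [ChartedSpace H' N] {f : M → N}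
    {Ψ : G → N → N} {x : M} (hf : MDifferentiableAt I I' f x) (h : ∀ g, f (Φ g x) = Ψ g (f x))
    (ξ : EG) : mder I I' f x (mder IG I (fun g => Φ g x) 1 ξ) =
      mder IG I' (fun g => Ψ g (f x)) 1 ξ := by
  have h1 := mder_comp (I := IG) (I' := I) (I'' := I') (x := (1 : G)) (g := f)
    (f := fun g => Φ g x) (by rw [hΦ.one_act]; exact hf)
    ((hΦ.contMDiff_orbit x).mdifferentiable (by simp) 1)
  rw [hΦ.one_act] at h1
  have h2 : (f ∘ fun g => Φ g x) = fun g => Ψ g (f x) := funext h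
  rw [h2] at h1
  exact (DFunLike.congr_fun h1 ξ).symm

theorem tangentLift_snd (g : G) (v : TangentBundle I M) :
    ((tangentLift I Φ g v).2 : E) = mder I I (Φ g) v.1 v.2 := rfl

theorem cotangentLift_fst (g : G) (α : CotangentBundle I M) :
    (cotangentLift I Φ g α).1 = Φ g α.1 := rfl

theorem cov_cotangentLift (g : G) (α : CotangentBundle I M) :
    cov (cotangentLift I Φ g α).2 = cov α.2 ∘L mder I I (Φ g⁻¹) (Φ g α.1) := rfl

/-- The tangent lift of a smooth action is a smooth action. -/
theorem IsSmoothAction.tangentLift (hΦ : IsSmoothAction IG I Φ) :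
    IsSmoothAction IG I.tangent (tangentLift I Φ) where
  one_act v := tangent_ext (hΦ.one_act _) (by rw [tangentLift_snd, hΦ.mder_one]; rfl)
  mul_act g h v := tangent_ext (hΦ.mul_act _ _ _) (by
    rw [tangentLift_snd, hΦ.mder_mul]; rfl)
  contMDiff_act := by
    rintro ⟨g₀, v₀⟩
    refine (contMDiffAt_tangent_iff (x₀ := Φ g₀ v₀.1) (mem_extChartAt_source _)).2 ⟨?_, ?_⟩
    · exact (hΦ.contMDiff_act.comp
        (contMDiff_fst.prodMk (contMDiff_proj_tangent.comp contMDiff_snd))) _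
    -- in charts, the fibre component is the derivative of the action applied to that of the vector
    · have h1 := contMDiffAt_mder (I := I) (I' := I) (I'' := IG.prod I.tangent)
        (f := fun (p : G × TangentBundle I M) x => Φ p.1 x) (g := fun p => p.2.1)
        (z₀ := (g₀, v₀))
        ((hΦ.contMDiff_act.comp ((contMDiff_fst.comp contMDiff_fst).prodMk contMDiff_snd)) _)
        ((contMDiff_proj_tangent.comp contMDiff_snd) _) rfl rfl
      have h2 := ((contMDiffAt_tangent_iff (I := I) (I'' := IG.prod I.tangent)
        (f := fun p : G × TangentBundle I M => p.2)
        (z₀ := (g₀, v₀)) (x₀ := v₀.1) (mem_extChartAt_source _)).1 contMDiffAt_snd).2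
      refine (h1.clm_apply h2).congr_of_eventuallyEq ?_
      have h3 : ContinuousAt (fun p : G × TangentBundle I M => p.2.1) (g₀, v₀) :=
        ((contMDiff_proj_tangent (I := I) (M := M)).continuous.comp continuous_snd).continuousAt
      filter_upwards [h3.eventually
        (eventually_mem_source (I := I) (mem_extChartAt_source v₀.1))] with p hp
      simp only [ContinuousLinearMap.comp_apply]
      erw [chartDerivSymm_apply hp]
      rfl

/-- The cotangent lift of a smooth action is a smooth action. -/
theorem IsSmoothAction.cotangentLift (hΦ : IsSmoothAction IG I Φ) :
    IsSmoothAction IG (cotangentModel I) (cotangentLift I Φ) where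
  one_act v := cotangent_ext (hΦ.one_act _) (by
    rw [cov_cotangentLift, inv_one, hΦ.mder_one]; rfl)
  mul_act g h v := cotangent_ext (hΦ.mul_act _ _ _) (by
    rw [cov_cotangentLift, cov_cotangentLift, cov_cotangentLift, cotangentLift_fst, mul_inv_rev,
      hΦ.mder_mul, hΦ.mul_act, hΦ.inv_act]; rfl)
  contMDiff_act := by
    rintro ⟨g₀, α₀⟩
    refine (contMDiffAt_cotangent_iff (x₀ := Φ g₀ α₀.1) (mem_extChartAt_source _)).2 ⟨?_, ?_⟩
    · exact (hΦ.contMDiff_act.comp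
        (contMDiff_fst.prodMk (contMDiff_proj_cotangent.comp contMDiff_snd))) _
    · have hp : ContMDiff (IG.prod (cotangentModel I)) I ∞
          (fun p : G × CotangentBundle I M => Φ p.1 p.2.1) :=
        hΦ.contMDiff_act.comp
          (contMDiff_fst.prodMk (contMDiff_proj_cotangent.comp contMDiff_snd))
      have h1 := contMDiffAt_mder (I := I) (I' := I) (I'' := IG.prod (cotangentModel I))
        (f := fun (p : G × CotangentBundle I M) x => Φ p.1⁻¹ x) (g := fun p => Φ p.1 p.2.1)
        (z₀ := (g₀, α₀)) (y₀ := α₀.1)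
        ((hΦ.contMDiff_act.comp
          (((contMDiff_inv IG ∞).comp (contMDiff_fst.comp contMDiff_fst)).prodMk
            contMDiff_snd)) _)
        (hp _) rfl (hΦ.inv_act _ _)
      have h2 := ((contMDiffAt_cotangent_iff (I := I) (I'' := IG.prod (cotangentModel I))
        (f := fun p : G × CotangentBundle I M => p.2)
        (z₀ := (g₀, α₀)) (x₀ := α₀.1) (mem_extChartAt_source _)).1 contMDiffAt_snd).2
      refine (h2.clm_comp h1).congr_of_eventuallyEq ?_
      have h3 : ContinuousAt (fun p : G × CotangentBundle I M => p.2.1) (g₀, α₀) :=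
        ((contMDiff_proj_cotangent (I := I) (M := M)).continuous.comp continuous_snd).continuousAt
      filter_upwards [h3.eventually
        (eventually_mem_source (I := I) (mem_extChartAt_source α₀.1))] with p hp
      simp only [hΦ.inv_act, cov_cotangentLift]
      ext w
      simp only [ContinuousLinearMap.comp_apply]
      erw [chartDerivSymm_apply hp]
      rfl

theorem cotangentMomentum_apply (α : CotangentBundle I M) (ξ : EG) :
    cotangentMomentum IG I Φ α ξ = cov α.2 (mder IG I (fun g => Φ g α.1) 1 ξ) := rfl

/-- The momentum map of a cotangent lift is smooth: in a chart, it is the composition of a covector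
with the derivative of the orbit map, which depends smoothly on the base point. -/
theorem contMDiff_cotangentMomentum (hΦ : IsSmoothAction IG I Φ) :
    ContMDiff (cotangentModel I) 𝓘(ℝ, EG →L[ℝ] ℝ) ∞ (cotangentMomentum IG I Φ) := by
  intro α₀
  have h1 := contMDiffAt_mder (I := IG) (I' := I) (I'' := cotangentModel I)
    (f := fun (α : CotangentBundle I M) g => Φ g α.1) (g := fun _ => (1 : G))
    (z₀ := α₀) (y₀ := α₀.1) (x₀ := (1 : G))
    ((hΦ.contMDiff_act.comp
      (contMDiff_snd.prodMk (contMDiff_proj_cotangent.comp contMDiff_fst))) _)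
    contMDiffAt_const rfl (hΦ.one_act _)
  have h2 := ((contMDiffAt_cotangent_iff (I := I) (f := fun p : CotangentBundle I M => p)
    (z₀ := α₀) (x₀ := α₀.1) (mem_extChartAt_source _)).1 contMDiffAt_id).2
  refine (h2.clm_comp h1).congr_of_eventuallyEq ?_
  have h3 : ContinuousAt (fun p : CotangentBundle I M => p.1) α₀ :=
    (contMDiff_proj_cotangent (I := I) (M := M)).continuous.continuousAt
  filter_upwards [h3.eventually
    (eventually_mem_source (I := I) (mem_extChartAt_source α₀.1))] with p hp
  ext w
  rw [cotangentMomentum_apply, chartDerivSymm_self]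
  simp only [ContinuousLinearMap.comp_apply, hΦ.one_act]
  erw [chartDerivSymm_apply hp]
  rfl

/-- The infinitesimal generators of an action are `Ad`-equivariant. -/
theorem mder_inv_generator (hΦ : IsSmoothAction IG I Φ) (g : G) (x : M) (ξ : EG) :
    mder I I (Φ g⁻¹) (Φ g x) (mder IG I (fun h => Φ h (Φ g x)) 1 ξ) =
      mder IG I (fun h => Φ h x) 1 (adjoint IG G g⁻¹ ξ) := by
  have h1 : (Φ g⁻¹ ∘ fun h => Φ h (Φ g x)) = (fun h => Φ h x) ∘ fun h => g⁻¹ * h * g⁻¹⁻¹ := by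
    funext h
    simp only [Function.comp_apply, ← hΦ.mul_act, inv_inv, mul_assoc]
  have hc : ContMDiff IG IG ∞ (fun h : G => g⁻¹ * h * g⁻¹⁻¹) :=
    (contMDiff_mul_right (a := g⁻¹⁻¹)).comp (contMDiff_mul_left (a := g⁻¹))
  have e : g⁻¹ * 1 * g⁻¹⁻¹ = 1 := by simp
  have h2 := mder_comp (I := IG) (I' := I) (I'' := I) (x := (1 : G)) (g := Φ g⁻¹)
    (f := fun h => Φ h (Φ g x)) (hΦ.mdifferentiable _ _)
    ((hΦ.contMDiff_orbit _).mdifferentiable (by simp) _)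
  have h3 := mder_comp (I := IG) (I' := IG) (I'' := I) (x := (1 : G)) (g := fun h => Φ h x)
    (f := fun h => g⁻¹ * h * g⁻¹⁻¹) ((hΦ.contMDiff_orbit _).mdifferentiable (by simp) _)
    (hc.mdifferentiable (by simp) _)
  rw [h1, h3, e, hΦ.one_act] at h2
  exact (DFunLike.congr_fun h2 ξ).symm

/-- The momentum map of a cotangent lift is `Ad^*`-equivariant. -/
theorem cotangentMomentum_cotangentLift (hΦ : IsSmoothAction IG I Φ) (g : G)
    (α : CotangentBundle I M) (ξ : EG) :
    cotangentMomentum IG I Φ (cotangentLift I Φ g α) ξ =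
      cotangentMomentum IG I Φ α (adjoint IG G g⁻¹ ξ) := by
  rw [cotangentMomentum_apply, cov_cotangentLift, ContinuousLinearMap.comp_apply,
    cotangentLift_fst, mder_inv_generator hΦ]
  rfl

end Lifts

section CanonicalForm

variable {EG : Type*} [NormedAddCommGroup EG] [NormedSpace ℝ EG]
  {HG : Type*} [TopologicalSpace HG] {IG : ModelWithCorners ℝ EG HG} [IG.Boundaryless]
  {G : Type*} [TopologicalSpace G] [ChartedSpace HG G] [Group G] [LieGroup IG ∞ G]
  {E : Type*} [NormedAddCommGroup E] [NormedSpace ℝ E]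
  {H : Type*} [TopologicalSpace H] {I : ModelWithCorners ℝ E H} [I.Boundaryless]
  {M : Type*} [TopologicalSpace M] [ChartedSpace H M] [IsManifold I ∞ M]

/-! ### The canonical symplectic form in charts -/

theorem cov_liouvilleForm (α : CotangentBundle I M) :
    cov (liouvilleForm I M α) =
      cov α.2 ∘L mder (cotangentModel I) I (fun β : CotangentBundle I M => β.1) α := rfl

/-- In charts, the projection `T*M → M` is `(q, p) ↦ q`. -/
theorem chartDeriv_mder_proj {x₀ : CotangentBundle I M} {α : CotangentBundle I M}
    (h : α.1 ∈ (extChartAt I x₀.1).source) :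
    chartDeriv I x₀.1 α.1 ∘L mder (cotangentModel I) I (fun β : CotangentBundle I M => β.1) α =
      .fst ℝ E (E →L[ℝ] ℝ) ∘L chartDeriv (cotangentModel I) x₀ α := by
  have hα : α ∈ (extChartAt (cotangentModel I) x₀).source := by
    rw [extChartAt_cotangent_source]; exact h
  have := chartDeriv_comp_mder (I := cotangentModel I) (I' := I)
    (f := fun β : CotangentBundle I M => β.1) (x := α) (x₀ := x₀) (z₀ := x₀.1) (F := Prod.fst)
    (contMDiff_proj_cotangent.mdifferentiable (by simp) α) hα h differentiableAt_fst (by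
      filter_upwards [eventually_mem_source hα] with β hβ
      rw [extChartAt_cotangent_source] at hβ
      rw [extChartAt_cotangent hβ])
  rwa [fderiv_fst] at this

/-- In the charts of `T*M`, the Liouville form is `p dq`. -/
theorem oneFormInChart_liouville {α₀ : CotangentBundle I M} {Y : E × (E →L[ℝ] ℝ)}
    (hY : Y ∈ (extChartAt (cotangentModel I) α₀).target) :
    oneFormInChart (cotangentModel I) (liouvilleForm I M) α₀ Y = Y.2 ∘L .fst ℝ E (E →L[ℝ] ℝ) := by
  obtain ⟨α, hα, rfl⟩ : ∃ α ∈ (extChartAt (cotangentModel I) α₀).source,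
      extChartAt (cotangentModel I) α₀ α = Y :=
    ⟨_, (extChartAt (cotangentModel I) α₀).map_target hY,
      (extChartAt (cotangentModel I) α₀).right_inv hY⟩
  have hα' := hα
  rw [extChartAt_cotangent_source] at hα'
  rw [oneFormInChart_eq, cov_eq_of_eq (θ := liouvilleForm I M)
    ((extChartAt (cotangentModel I) α₀).left_inv hα), cov_liouvilleForm]
  have h1 := chartDeriv_mder_proj hα'
  have h2 := congrArg Prod.snd (extChartAt_cotangent hα')
  refine ContinuousLinearMap.ext fun W => ?_
  have h3 := DFunLike.congr_fun h1 (chartDerivSymm (cotangentModel I) α₀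
    (extChartAt (cotangentModel I) α₀ α) W)
  simp only [ContinuousLinearMap.comp_apply, chartDeriv_symm_apply hα] at h3 ⊢
  rw [h2, ContinuousLinearMap.comp_apply, ← h3]
  congr 1
  exact (chartDerivSymm_apply hα' _).symm

variable (E) in
/-- The linear map `(δq, δp) ↦ (δp ∘ fst)`, the derivative of `p dq` on `E × E*`. -/
def liouvilleDeriv : (E × (E →L[ℝ] ℝ)) →L[ℝ] (E × (E →L[ℝ] ℝ)) →L[ℝ] ℝ :=
  ContinuousLinearMap.comp ((ContinuousLinearMap.compL ℝ (E × (E →L[ℝ] ℝ)) E ℝ).flip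
    (.fst ℝ E (E →L[ℝ] ℝ))) (.snd ℝ E (E →L[ℝ] ℝ))

theorem liouvilleDeriv_apply (V W : E × (E →L[ℝ] ℝ)) : liouvilleDeriv E V W = V.2 W.1 := rfl

/-- A continuous bilinear form, as a map into the dual, is its own derivative. -/
theorem hasFDerivAt_bilinear {A B : Type*} [NormedAddCommGroup A] [NormedSpace ℝ A]
    [NormedAddCommGroup B] [NormedSpace ℝ B] (L : (A × B) →L[ℝ] (A × B) →L[ℝ] ℝ) (x : A × B) :
    HasFDerivAt (𝕜 := ℝ) L L x := L.hasFDerivAt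

theorem hasFDerivAt_liouville {α₀ α : CotangentBundle I M}
    (hα : α.1 ∈ (extChartAt I α₀.1).source) :
    HasFDerivAt (oneFormInChart (cotangentModel I) (liouvilleForm I M) α₀)
      (liouvilleDeriv E) (extChartAt (cotangentModel I) α₀ α) := by
  have hα' : α ∈ (extChartAt (cotangentModel I) α₀).source := by
    rw [extChartAt_cotangent_source]; exact hα
  have h := hasFDerivAt_bilinear (liouvilleDeriv E) (extChartAt (cotangentModel I) α₀ α)
  refine h.congr_of_eventuallyEq ?_
  filter_upwards [eventually_mem_target hα'] with Y hY
  rw [oneFormInChart_liouville hY]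
  rfl

theorem extDerivIn_liouville {α₀ α : CotangentBundle I M}
    (hα : α.1 ∈ (extChartAt I α₀.1).source) (V W : E × (E →L[ℝ] ℝ)) :
    extDerivIn (liouvilleForm I M) α₀ α V W =
      (chartDeriv (cotangentModel I) α₀ α V).2 (chartDeriv (cotangentModel I) α₀ α W).1 -
      (chartDeriv (cotangentModel I) α₀ α W).2 (chartDeriv (cotangentModel I) α₀ α V).1 := by
  rw [extDerivIn, vecExtDeriv, (hasFDerivAt_liouville hα).fderiv, liouvilleDeriv_apply,
    liouvilleDeriv_apply]

/-- In the charts of `T*M`, the canonical form is `dq ∧ dp`. -/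
theorem canonicalForm_apply {α₀ α : CotangentBundle I M} (hα : α.1 ∈ (extChartAt I α₀.1).source)
    (V W : TangentSpace (cotangentModel I) α) :
    canonicalForm I M α V W =
      (chartDeriv (cotangentModel I) α₀ α W).2 (chartDeriv (cotangentModel I) α₀ α V).1 -
      (chartDeriv (cotangentModel I) α₀ α V).2 (chartDeriv (cotangentModel I) α₀ α W).1 := by
  have hα' : α ∈ (extChartAt (cotangentModel I) α₀).source := by
    rw [extChartAt_cotangent_source]; exact hα
  have h := hasFDerivAt_liouville hα
  have h2 := oneFormExtDeriv_eq_extDerivIn hα' h.differentiableAt V W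
  refine (congrArg Neg.neg (h2.trans (extDerivIn_liouville hα V W))).trans ?_
  exact neg_sub _ _

theorem canonicalForm_antisymm (α : CotangentBundle I M) (V W : TangentSpace (cotangentModel I) α) :
    canonicalForm I M α V W = - canonicalForm I M α W V := by
  rw [canonicalForm_apply (mem_extChartAt_source α.1), canonicalForm_apply
    (mem_extChartAt_source α.1)]
  ring

/-! ### Cotangent lifts are Hamiltonian -/

variable {Φ : G → M → M}

theorem mder_proj_cotangentLift (hΦ : IsSmoothAction IG I Φ) (g : G) (α : CotangentBundle I M) :
    mder (cotangentModel I) I (fun β : CotangentBundle I M => β.1) (cotangentLift I Φ g α) ∘L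
      mder (cotangentModel I) (cotangentModel I) (cotangentLift I Φ g) α =
    mder I I (Φ g) α.1 ∘L mder (cotangentModel I) I (fun β : CotangentBundle I M => β.1) α := by
  have hπ := (contMDiff_proj_cotangent (I := I) (M := M)).mdifferentiable (by simp)
  rw [← mder_comp (hπ _) (hΦ.cotangentLift.mdifferentiable g α)]
  exact mder_comp (hΦ.mdifferentiable g _) (hπ _)

/-- The Liouville form is invariant under cotangent lifts. -/
theorem liouvilleForm_invariant (hΦ : IsSmoothAction IG I Φ) (g : G) (α : CotangentBundle I M) :
    cov (liouvilleForm I M (cotangentLift I Φ g α)) ∘L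
      mder (cotangentModel I) (cotangentModel I) (cotangentLift I Φ g) α =
    cov (liouvilleForm I M α) := by
  rw [cov_liouvilleForm, ContinuousLinearMap.comp_assoc, mder_proj_cotangentLift hΦ,
    cov_cotangentLift, cov_liouvilleForm, ContinuousLinearMap.comp_assoc,
    ← ContinuousLinearMap.comp_assoc (mder I I (Φ g⁻¹) _), hΦ.mder_inv_comp,
    ContinuousLinearMap.id_comp]

theorem bilinPullback_apply {E' : Type*} [NormedAddCommGroup E'] [NormedSpace ℝ E']
    {H' : Type*} [TopologicalSpace H'] {I' : ModelWithCorners ℝ E' H'}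
    {N : Type*} [TopologicalSpace N] [ChartedSpace H' N] (f : M → N)
    (Ω : ∀ y : N, TangentSpace I' y →L[ℝ] TangentSpace I' y →L[ℝ] ℝ) (x : M)
    (v w : TangentSpace I x) : bilinPullback I I' f Ω x v w =
      Ω (f x) (mder I I' f x v : E') (mder I I' f x w : E') := rfl

/-- Cotangent lifts preserve the canonical form. -/
theorem bilinPullback_canonicalForm (hΦ : IsSmoothAction IG I Φ) (g : G) :
    bilinPullback (cotangentModel I) (cotangentModel I) (cotangentLift I Φ g)
      (canonicalForm I M) = canonicalForm I M := by
  funext α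
  ext V W
  have h := hΦ.cotangentLift.contMDiff g
  have h2 := (extDerivIn_pullback (f := cotangentLift I Φ g) (x := α) (x₀ := α)
    (z₀ := cotangentLift I Φ g α) (η := liouvilleForm I M) (θ := liouvilleForm I M)
    (Eventually.of_forall fun β => h β) (mem_extChartAt_source _) (mem_extChartAt_source _)
    (hasFDerivAt_liouville (mem_extChartAt_source _)).differentiableAt
    (Eventually.of_forall fun β => (liouvilleForm_invariant hΦ g β).symm)).2 V W
  rw [bilinPullback_apply]
  exact congrArg Neg.neg h2.symm

/-- The generator of a cotangent lift projects to the generator of the action. -/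
theorem mder_proj_generator (hΦ : IsSmoothAction IG I Φ) (α : CotangentBundle I M) (ξ : EG) :
    mder (cotangentModel I) I (fun β : CotangentBundle I M => β.1) α
      (mder IG (cotangentModel I) (fun g => cotangentLift I Φ g α) 1 ξ) =
    mder IG I (fun g => Φ g α.1) 1 ξ := by
  have hπ := (contMDiff_proj_cotangent (I := I) (M := M)).mdifferentiable (by simp)
  exact hΦ.cotangentLift.mder_generator (hπ _) (fun _ => rfl) ξ

/-- The Liouville form evaluates on a generator to the momentum map. -/
theorem liouvilleForm_generator (hΦ : IsSmoothAction IG I Φ) (α : CotangentBundle I M) (ξ : EG) :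
    cov (liouvilleForm I M α) (mder IG (cotangentModel I) (fun g => cotangentLift I Φ g α) 1 ξ) =
      cotangentMomentum IG I Φ α ξ := by
  rw [cov_liouvilleForm, ContinuousLinearMap.comp_apply, mder_proj_generator hΦ]
  rfl

/-- `dλ (ξ, ·) = - d (λ (ξ))`, since the Liouville form `λ` is invariant. -/
theorem extDerivIn_liouville_generator (hΦ : IsSmoothAction IG I Φ) (α : CotangentBundle I M)
    (ξ : EG) (V : E × (E →L[ℝ] ℝ)) :
    extDerivIn (liouvilleForm I M) α α
      (mder IG (cotangentModel I) (fun g => cotangentLift I Φ g α) 1 ξ) V =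
    - mder (cotangentModel I) 𝓘(ℝ, ℝ) (fun β => cotangentMomentum IG I Φ β ξ) α V := by
  have h := oneFormExtDeriv_generator (IG := IG) hΦ.cotangentLift.one_act
    hΦ.cotangentLift.contMDiff_act (θ := liouvilleForm I M) (x := α)
    (hasFDerivAt_liouville (mem_extChartAt_source _)).differentiableAt
    (liouvilleForm_invariant hΦ) ξ V
  simpa only [liouvilleForm_generator hΦ] using h

/-- The cotangent lift of a smooth action is Hamiltonian for the canonical form. Since the
Liouville form `λ` is invariant, `i_ξ ω = - i_ξ dλ = d (λ (ξ))`. -/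
theorem isHamiltonianAction_cotangentLift (hΦ : IsSmoothAction IG I Φ) :
    IsHamiltonianAction IG (cotangentModel I) (canonicalForm I M) (cotangentLift I Φ)
      (cotangentMomentum IG I Φ) where
  one_act := hΦ.cotangentLift.one_act
  mul_act := hΦ.cotangentLift.mul_act
  contMDiff_act := hΦ.cotangentLift.contMDiff_act
  symplectic := bilinPullback_canonicalForm hΦ
  contMDiff_momentum := contMDiff_cotangentMomentum hΦ
  momentum α ξ V := neg_eq_iff_eq_neg.2 (extDerivIn_liouville_generator hΦ α ξ V)
  equivariant g α ξ := cotangentMomentum_cotangentLift hΦ g α ξ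

end CanonicalForm

section Pullback

variable {EG : Type*} [NormedAddCommGroup EG] [NormedSpace ℝ EG]
  {HG : Type*} [TopologicalSpace HG] {IG : ModelWithCorners ℝ EG HG} [IG.Boundaryless]
  {G : Type*} [TopologicalSpace G] [ChartedSpace HG G] [Group G] [LieGroup IG ∞ G]
  {E : Type*} [NormedAddCommGroup E] [NormedSpace ℝ E]
  {H : Type*} [TopologicalSpace H] {I : ModelWithCorners ℝ E H} [I.Boundaryless]
  {M : Type*} [TopologicalSpace M] [ChartedSpace H M] [IsManifold I ∞ M]
  {E' : Type*} [NormedAddCommGroup E'] [NormedSpace ℝ E']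
  {H' : Type*} [TopologicalSpace H'] {I' : ModelWithCorners ℝ E' H'} [I'.Boundaryless]
  {N : Type*} [TopologicalSpace N] [ChartedSpace H' N] [IsManifold I' ∞ N]

/-! ### Hamiltonian actions under pullbacks and tangent lifts -/

theorem IsHamiltonianAction.isSmoothAction
    {Ω : ∀ x : M, TangentSpace I x →L[ℝ] TangentSpace I x →L[ℝ] ℝ} {Φ : G → M → M}
    {J : M → EG →L[ℝ] ℝ} (h : IsHamiltonianAction IG I Ω Φ J) : IsSmoothAction IG I Φ :=
  ⟨h.one_act, h.mul_act, h.contMDiff_act⟩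

/-- The value at a point of a field of bilinear forms, as a function on the model space. -/
def formAt (Ω : ∀ x : M, TangentSpace I x →L[ℝ] TangentSpace I x →L[ℝ] ℝ) (x : M) (v w : E) : ℝ :=
  Ω x v w

theorem IsHamiltonianAction.symplectic_apply
    {Ω : ∀ x : M, TangentSpace I x →L[ℝ] TangentSpace I x →L[ℝ] ℝ} {Φ : G → M → M}
    {J : M → EG →L[ℝ] ℝ} (h : IsHamiltonianAction IG I Ω Φ J) (g : G) (x : M) (v w : E) :
    formAt Ω (Φ g x) (mder I I (Φ g) x v) (mder I I (Φ g) x w) = formAt Ω x v w :=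
  DFunLike.congr_fun (DFunLike.congr_fun (congrFun (h.symplectic g) x) v) w

/-- The derivative of `y ↦ J y ξ` is the value at `ξ` of the derivative of `J`. -/
theorem mder_apply {J : M → EG →L[ℝ] ℝ} {x : M}
    (hJ : MDifferentiableAt I 𝓘(ℝ, EG →L[ℝ] ℝ) J x) (ξ : EG) (v : E) :
    mder I 𝓘(ℝ, ℝ) (fun y => J y ξ) x v = mder I 𝓘(ℝ, EG →L[ℝ] ℝ) J x v ξ := by
  have h := mder_comp (g := fun L : EG →L[ℝ] ℝ => L ξ) (I' := 𝓘(ℝ, EG →L[ℝ] ℝ))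
    (I'' := 𝓘(ℝ, ℝ)) (ContinuousLinearMap.apply ℝ ℝ ξ).differentiableAt.mdifferentiableAt hJ
  rw [mder_vectorSpace] at h
  have h2 : fderiv ℝ (fun L : EG →L[ℝ] ℝ => L ξ) (J x) = ContinuousLinearMap.apply ℝ ℝ ξ :=
    (ContinuousLinearMap.apply ℝ ℝ ξ).fderiv
  rw [h2] at h
  exact DFunLike.congr_fun h v

/-- The momentum map condition for `- f^* Ω` and `- J ∘ f`: the map `f` relates the generators of
the two actions. -/
theorem IsHamiltonianAction.neg_pullback_momentum
    {Ω : ∀ x : N, TangentSpace I' x →L[ℝ] TangentSpace I' x →L[ℝ] ℝ} {Ψ : G → N → N}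
    {J : N → EG →L[ℝ] ℝ} (h : IsHamiltonianAction IG I' Ω Ψ J) {Φ : G → M → M}
    (hΦ : IsSmoothAction IG I Φ) {f : M → N} (hf : ContMDiff I I' ∞ f)
    (hequiv : ∀ g x, f (Φ g x) = Ψ g (f x)) (x : M) (ξ : EG) (v : E) :
    - formAt Ω (f x) (mder I I' f x (mder IG I (fun g => Φ g x) 1 ξ)) (mder I I' f x v) =
      mder I 𝓘(ℝ, ℝ) (fun y => (- J (f y)) ξ) x v := by
  have hfd := hf.mdifferentiable (by simp)
  have hJd := h.contMDiff_momentum.mdifferentiable (by simp)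
  have h1 : mder I I' f x (mder IG I (fun g => Φ g x) 1 ξ) =
      mder IG I' (fun g => Ψ g (f x)) 1 ξ :=
    hΦ.mder_generator (hfd x) (fun g => hequiv g x) ξ
  have h3 : formAt Ω (f x) (mder IG I' (fun g => Ψ g (f x)) 1 ξ) (mder I I' f x v) =
      mder I' 𝓘(ℝ, ℝ) (fun y => J y ξ) (f x) (mder I I' f x v) :=
    h.momentum (f x) ξ (mder I I' f x v)
  have h4 : mder I 𝓘(ℝ, EG →L[ℝ] ℝ) (fun y => - J (f y)) x =
      - (mder I' 𝓘(ℝ, EG →L[ℝ] ℝ) J (f x) ∘L mder I I' f x) := by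
    rw [← mder_comp (hJd _) (hfd x)]
    exact mfderiv_neg
  rw [h1, h3, mder_apply (hJd _), mder_apply (J := fun y => - J (f y))
    ((hJd _).comp x (hfd x)).neg, h4]
  rfl

/-- The pullback of a Hamiltonian action along a smooth equivariant map `f`, up to sign: the form
`- f^* Ω` has the momentum map `- J ∘ f`. -/
theorem IsHamiltonianAction.neg_pullback
    {Ω : ∀ x : N, TangentSpace I' x →L[ℝ] TangentSpace I' x →L[ℝ] ℝ} {Ψ : G → N → N}
    {J : N → EG →L[ℝ] ℝ} (h : IsHamiltonianAction IG I' Ω Ψ J) {Φ : G → M → M}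
    (hΦ : IsSmoothAction IG I Φ) {f : M → N} (hf : ContMDiff I I' ∞ f)
    (hequiv : ∀ g x, f (Φ g x) = Ψ g (f x)) :
    IsHamiltonianAction IG I (fun x => - bilinPullback I I' f Ω x) Φ (fun x => - J (f x)) where
  one_act := hΦ.one_act
  mul_act := hΦ.mul_act
  contMDiff_act := hΦ.contMDiff_act
  symplectic g := by
    have hΨ := h.isSmoothAction
    have hfd := hf.mdifferentiable (by simp)
    funext x
    have h1 : mder I I' f (Φ g x) ∘L mder I I (Φ g) x =
        mder I' I' (Ψ g) (f x) ∘L mder I I' f x := by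
      rw [← mder_comp (hfd _) (hΦ.mdifferentiable g x),
        ← mder_comp (hΨ.mdifferentiable g _) (hfd x)]
      exact congrArg (fun k => mder I I' k x) (funext (hequiv g))
    have h3 : ∀ u, mder I I' f (Φ g x) (mder I I (Φ g) x u) =
      mder I' I' (Ψ g) (f x) (mder I I' f x u) := DFunLike.congr_fun h1
    have h4 : ∀ v w : E, - formAt Ω (f (Φ g x)) (mder I I' f (Φ g x) (mder I I (Φ g) x v))
        (mder I I' f (Φ g x) (mder I I (Φ g) x w)) =
        - formAt Ω (f x) (mder I I' f x v) (mder I I' f x w) := fun v w => by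
      rw [h3, h3, hequiv, h.symplectic_apply]
    exact ContinuousLinearMap.ext fun v => ContinuousLinearMap.ext fun w => h4 v w
  contMDiff_momentum := (h.contMDiff_momentum.comp hf).neg
  momentum x ξ v := h.neg_pullback_momentum hΦ hf hequiv x ξ v
  equivariant g x ξ := by
    have := h.equivariant g (f x) ξ
    rw [← hequiv] at this
    exact congrArg Neg.neg this

variable {Ω : ∀ x : M, TangentSpace I x →L[ℝ] TangentSpace I x →L[ℝ] ℝ} {Φ : G → M → M}
  {J : M → EG →L[ℝ] ℝ}

/-- The map `b_Ω` of an invariant form is equivariant for the tangent and cotangent lifts. -/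
theorem IsHamiltonianAction.flat_tangentLift (h : IsHamiltonianAction IG I Ω Φ J) (g : G)
    (V : TangentBundle I M) :
    flat I Ω (tangentLift I Φ g V) = cotangentLift I Φ g (flat I Ω V) := by
  have hΦ := h.isSmoothAction
  refine cotangent_ext rfl (ContinuousLinearMap.ext fun W => ?_)
  rw [cov_cotangentLift]
  have h1 := h.symplectic_apply g V.1 V.2 (mder I I (Φ g⁻¹) (Φ g V.1) W)
  have h2 : mder I I (Φ g) V.1 (mder I I (Φ g⁻¹) (Φ g V.1) W) = W :=
    DFunLike.congr_fun (hΦ.mder_comp_inv g V.1) W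
  rw [h2] at h1
  exact h1

/-- `J_{T*M} ∘ b_Ω = - J_{TM}`. -/
theorem IsHamiltonianAction.cotangentMomentum_flat (h : IsHamiltonianAction IG I Ω Φ J)
    (hΩ : ∀ x v w, Ω x v w = - Ω x w v) (V : TangentBundle I M) :
    cotangentMomentum IG I Φ (flat I Ω V) = - tangentMomentum I J V := by
  refine ContinuousLinearMap.ext fun ξ => ?_
  have h1 := h.momentum V.1 ξ V.2
  have h2 := mder_apply (h.contMDiff_momentum.mdifferentiable (by simp) V.1) ξ V.2
  refine (hΩ V.1 V.2 _).trans (congrArg Neg.neg (h1.trans ?_))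
  exact h2

/-- The tangent lift of a Hamiltonian action is Hamiltonian for the complete lift of the form. -/
theorem IsHamiltonianAction.tangentLift (h : IsHamiltonianAction IG I Ω Φ J)
    (hΩ : ∀ x v w, Ω x v w = - Ω x w v)
    (hflat : ContMDiff I.tangent (cotangentModel I) ∞ (flat I Ω)) :
    IsHamiltonianAction IG I.tangent (completeLift I Ω) (tangentLift I Φ)
      (tangentMomentum I J) := by
  have h1 := (isHamiltonianAction_cotangentLift h.isSmoothAction).neg_pullback
    h.isSmoothAction.tangentLift hflat h.flat_tangentLift
  have h2 : (fun V => - cotangentMomentum IG I Φ (flat I Ω V)) = tangentMomentum I J := by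
    funext V
    rw [h.cotangentMomentum_flat hΩ, neg_neg]
  rw [h2] at h1
  exact h1

end Pullback

section LinearCharts

variable {E : Type*} [NormedAddCommGroup E] [NormedSpace ℝ E]
  {H : Type*} [TopologicalSpace H] {I : ModelWithCorners ℝ E H} [I.Boundaryless]
  {M : Type*} [TopologicalSpace M] [ChartedSpace H M] [IsManifold I ∞ M]
  {E' : Type*} [NormedAddCommGroup E'] [NormedSpace ℝ E']
  {H' : Type*} [TopologicalSpace H'] {I' : ModelWithCorners ℝ E' H'} [I'.Boundaryless]
  {N : Type*} [TopologicalSpace N] [ChartedSpace H' N] [IsManifold I' ∞ N]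

/-! ### Maps that are linear in charts -/

/-- A map `f : M → N` over a base `B` is bijective if it reads the same linear isomorphism `F` in
corresponding charts, whose domains are the parts of `M` and `N` over subsets `U q` of `B`. -/
theorem bijective_of_linear_in_charts {B : Type*} {U : B → Set B} (hU : ∀ q, q ∈ U q)
    {b : M → B} {c : N → B} {s : B → M} {t : B → N}
    (hs : ∀ q, (extChartAt I (s q)).source = b ⁻¹' U q)
    (ht : ∀ q, (extChartAt I' (t q)).source = c ⁻¹' U q)
    {f : M → N} (hf : ∀ x, c (f x) = b x) (F : E ≃L[ℝ] E')
    (hF : ∀ q x, b x ∈ U q → extChartAt I' (t q) (f x) = F (extChartAt I (s q) x))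
    (htarget : ∀ q p, p ∈ (extChartAt I (s q)).target ↔ F p ∈ (extChartAt I' (t q)).target) :
    Function.Bijective f := by
  constructor
  · intro x y hxy
    have hb : b x = b y := by rw [← hf, ← hf, hxy]
    have h1 := hF (b x) x (hU _)
    have h2 := hF (b x) y (by rw [← hb]; exact hU _)
    rw [hxy, h2] at h1
    refine (extChartAt I (s (b x))).injOn ?_ ?_ (F.injective h1).symm
    · rw [hs]; exact hU _
    · rw [hs, mem_preimage, ← hb]; exact hU _
  · intro y
    have hy : y ∈ (extChartAt I' (t (c y))).source := by rw [ht]; exact hU _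
    set p := F.symm (extChartAt I' (t (c y)) y) with hp
    have hFp : F p = extChartAt I' (t (c y)) y := F.apply_symm_apply _
    have hpt : p ∈ (extChartAt I (s (c y))).target := by
      rw [htarget, hFp]; exact (extChartAt I' (t (c y))).map_source hy
    set x := (extChartAt I (s (c y))).symm p with hx
    have hxs : x ∈ (extChartAt I (s (c y))).source := (extChartAt I (s (c y))).map_target hpt
    have hxU : b x ∈ U (c y) := by rw [hs] at hxs; exact hxs
    refine ⟨x, (extChartAt I' (t (c y))).injOn ?_ hy ?_⟩
    · rw [ht, mem_preimage, hf]; exact hxU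
    · rw [hF _ _ hxU, hx, (extChartAt I (s (c y))).right_inv hpt, hFp]

/-- A map over a base that reads the same linear map in corresponding charts is smooth. -/
theorem contMDiff_of_linear_in_charts {B : Type*} {U : B → Set B} (hU : ∀ q, q ∈ U q)
    {b : M → B} {c : N → B} {s : B → M} {t : B → N}
    (hs : ∀ q, (extChartAt I (s q)).source = b ⁻¹' U q)
    (ht : ∀ q, (extChartAt I' (t q)).source = c ⁻¹' U q)
    {f : M → N} (hf : ∀ x, c (f x) = b x) (F : E →L[ℝ] E')
    (hF : ∀ q x, b x ∈ U q → extChartAt I' (t q) (f x) = F (extChartAt I (s q) x)) :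
    ContMDiff I I' ∞ f := by
  intro x
  have hx : x ∈ (extChartAt I (s (b x))).source := by rw [hs]; exact hU _
  have hfx : f x ∈ (extChartAt I' (t (b x))).source := by rw [ht, mem_preimage, hf]; exact hU _
  have h1 : ContMDiffAt I 𝓘(ℝ, E) ∞ (extChartAt I (s (b x))) x :=
    contMDiffAt_extChartAt' (by simpa using hx)
  have h2 : ContMDiffAt 𝓘(ℝ, E) 𝓘(ℝ, E') ∞ F (extChartAt I (s (b x)) x) :=
    F.contDiff.contMDiff.contMDiffAt
  have h3 : ContMDiffAt 𝓘(ℝ, E') I' ∞ (extChartAt I' (t (b x))).symm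
      (F (extChartAt I (s (b x)) x)) := by
    rw [← hF _ _ (hU _)]
    exact contMDiffAt_chart_symm hfx
  refine (h3.comp x (h2.comp x h1)).congr_of_eventuallyEq ?_
  filter_upwards [eventually_mem_source hx] with y hy
  rw [hs] at hy
  have hfy : f y ∈ (extChartAt I' (t (b x))).source := by rw [ht, mem_preimage, hf]; exact hy
  rw [Function.comp_apply, Function.comp_apply, ← hF _ _ hy, (extChartAt I' (t (b x))).left_inv hfy]

/-- A map over a base that reads the same linear isomorphism in corresponding charts is a
diffeomorphism. -/
theorem exists_diffeomorph_of_linear_in_charts {B : Type*} {U : B → Set B} (hU : ∀ q, q ∈ U q)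
    {b : M → B} {c : N → B} {s : B → M} {t : B → N}
    (hs : ∀ q, (extChartAt I (s q)).source = b ⁻¹' U q)
    (ht : ∀ q, (extChartAt I' (t q)).source = c ⁻¹' U q)
    {f : M → N} (hf : ∀ x, c (f x) = b x) (F : E ≃L[ℝ] E')
    (hF : ∀ q x, b x ∈ U q → extChartAt I' (t q) (f x) = F (extChartAt I (s q) x))
    (htarget : ∀ q p, p ∈ (extChartAt I (s q)).target ↔ F p ∈ (extChartAt I' (t q)).target) :
    ∃ D : Diffeomorph I I' M N ∞, ⇑D = f := by
  let e := Equiv.ofBijective f (bijective_of_linear_in_charts hU hs ht hf F hF htarget)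
  have he : ∀ y, f (e.symm y) = y := e.apply_symm_apply
  have hb : ∀ y, b (e.symm y) = c y := fun y => by rw [← hf, he]
  refine ⟨⟨e, contMDiff_of_linear_in_charts hU hs ht hf F hF,
    contMDiff_of_linear_in_charts hU ht hs hb F.symm fun q y hy => ?_⟩, rfl⟩
  have h := hF q (e.symm y) (by rwa [hb])
  rw [he] at h
  rw [h]
  exact (F.symm_apply_apply _).symm

end LinearCharts

section Sum

variable {EG : Type*} [NormedAddCommGroup EG] [NormedSpace ℝ EG]
  {HG : Type*} [TopologicalSpace HG] {IG : ModelWithCorners ℝ EG HG} [IG.Boundaryless]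
  {G : Type*} [TopologicalSpace G] [ChartedSpace HG G] [Group G] [LieGroup IG ∞ G]
  {E : Type*} [NormedAddCommGroup E] [NormedSpace ℝ E]
  {H : Type*} [TopologicalSpace H] {I : ModelWithCorners ℝ E H} [I.Boundaryless]
  {M : Type*} [TopologicalSpace M] [ChartedSpace H M] [IsManifold I ∞ M]
  {E'' : Type*} [NormedAddCommGroup E''] [NormedSpace ℝ E'']
  {H'' : Type*} [TopologicalSpace H''] {I'' : ModelWithCorners ℝ E'' H''}
  {P : Type*} [TopologicalSpace P] [ChartedSpace H'' P]

/-! ### The fibre product of the cotangent and tangent bundles -/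

/-- A map into `T*M ×_M TM` is smooth iff its two components are smooth. -/
theorem contMDiffAt_sum_iff {f : P → CotangentTangentBundle I M} {z₀ : P} :
    ContMDiffAt I'' (cotangentTangentModel I) ∞ f z₀ ↔
      ContMDiffAt I'' (cotangentModel I) ∞ (fun z => toCotangent I M (f z)) z₀ ∧
      ContMDiffAt I'' I.tangent ∞ (fun z => toTangent I M (f z)) z₀ := by
  set x₀ := (f z₀).1 with hx₀
  have h₀ : (f z₀).1 ∈ (extChartAt I x₀).source := mem_extChartAt_source _
  have hb := FiberBundle.mem_baseSet_trivializationAt' (F := (E →L[ℝ] ℝ) × E)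
    (E := (fun x : M => CotangentSpace I x) ×ᵇ (TangentSpace I : M → Type _)) x₀
  have h1 := Trivialization.contMDiffAt_iff (IM := I'') (IB := I) (n := ∞) (f := f) (x₀ := z₀)
    (e := trivializationAt ((E →L[ℝ] ℝ) × E)
      ((fun x : M => CotangentSpace I x) ×ᵇ (TangentSpace I : M → Type _)) x₀)
    ((Trivialization.mem_source _).2 hb)
  rw [h1, contMDiffAt_cotangent_iff (I := I) (f := fun z => toCotangent I M (f z)) (x₀ := x₀) h₀,
    contMDiffAt_tangent_iff (I := I) (f := fun z => toTangent I M (f z)) (x₀ := x₀) h₀]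
  have h2 : ContMDiffAt I'' I ∞ (fun z => (f z).1) z₀ →
      (ContMDiffAt I'' 𝓘(ℝ, (E →L[ℝ] ℝ) × E) ∞ (fun z => (trivializationAt ((E →L[ℝ] ℝ) × E)
      ((fun x : M => CotangentSpace I x) ×ᵇ (TangentSpace I : M → Type _)) x₀ (f z)).2) z₀ ↔
      ContMDiffAt I'' 𝓘(ℝ, E →L[ℝ] ℝ) ∞
        (fun z => cov (f z).2.1 ∘L chartDerivSymm I x₀ (extChartAt I x₀ (f z).1)) z₀ ∧
      ContMDiffAt I'' 𝓘(ℝ, E) ∞ (fun z => chartDeriv I x₀ (f z).1 (f z).2.2) z₀) := by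
    intro h
    have h3 : (fun z => (trivializationAt ((E →L[ℝ] ℝ) × E)
        ((fun x : M => CotangentSpace I x) ×ᵇ (TangentSpace I : M → Type _)) x₀ (f z)).2) =ᶠ[𝓝 z₀]
        fun z => (cov (f z).2.1 ∘L chartDerivSymm I x₀ (extChartAt I x₀ (f z).1),
          chartDeriv I x₀ (f z).1 (f z).2.2) := by
      filter_upwards [h.continuousAt.eventually (eventually_mem_source h₀)] with z hz
      have := extChartAt_sum (v₀ := ⟨x₀, 0⟩) (v := f z) hz
      rw [FiberBundle.extChartAt] at this
      have h4 := congrArg Prod.snd this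
      exact h4
    rw [h3.contMDiffAt_iff]
    exact contMDiffAt_prod_module_iff _
  constructor
  · rintro ⟨h, h'⟩
    exact ⟨⟨h, ((h2 h).1 h').1⟩, ⟨h, ((h2 h).1 h').2⟩⟩
  · rintro ⟨⟨h, h'⟩, ⟨-, h''⟩⟩
    exact ⟨h, (h2 h).2 ⟨h', h''⟩⟩

theorem contMDiff_toCotangent :
    ContMDiff (cotangentTangentModel I) (cotangentModel I) ∞ (toCotangent I M) := fun _ =>
  (contMDiffAt_sum_iff.1 contMDiffAt_id).1

theorem contMDiff_toTangent :
    ContMDiff (cotangentTangentModel I) I.tangent ∞ (toTangent I M) := fun _ =>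
  (contMDiffAt_sum_iff.1 contMDiffAt_id).2

theorem sum_ext {z w : CotangentTangentBundle I M} (h : toCotangent I M z = toCotangent I M w)
    (h' : toTangent I M z = toTangent I M w) : z = w := by
  obtain ⟨x, a, v⟩ := z
  obtain ⟨y, b, w⟩ := w
  obtain rfl : x = y := congrArg TotalSpace.proj h
  have h1 : a = b := TotalSpace.mk_inj.1 h
  have h2 : v = w := TotalSpace.mk_inj.1 h'
  rw [h1, h2]

variable (I) in
/-- The action on `T*M ×_M TM` induced by an action on `M`. -/
def sumLift (Φ : G → M → M) (g : G) (z : CotangentTangentBundle I M) :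
    CotangentTangentBundle I M :=
  ⟨Φ g z.1, ((cotangentLift I Φ g (toCotangent I M z)).2,
    (tangentLift I Φ g (toTangent I M z)).2)⟩

variable {Φ : G → M → M}

theorem toCotangent_sumLift (g : G) (z : CotangentTangentBundle I M) :
    toCotangent I M (sumLift I Φ g z) = cotangentLift I Φ g (toCotangent I M z) := rfl

theorem toTangent_sumLift (g : G) (z : CotangentTangentBundle I M) :
    toTangent I M (sumLift I Φ g z) = tangentLift I Φ g (toTangent I M z) := rfl

theorem isSmoothAction_sumLift (hΦ : IsSmoothAction IG I Φ) :
    IsSmoothAction IG (cotangentTangentModel I) (sumLift I Φ) where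
  one_act z := sum_ext (hΦ.cotangentLift.one_act (toCotangent I M z))
    (hΦ.tangentLift.one_act (toTangent I M z))
  mul_act g h z := sum_ext (hΦ.cotangentLift.mul_act g h (toCotangent I M z))
    (hΦ.tangentLift.mul_act g h (toTangent I M z))
  contMDiff_act p := contMDiffAt_sum_iff.2
    ⟨(hΦ.cotangentLift.contMDiff_act.comp
      (contMDiff_fst.prodMk (contMDiff_toCotangent.comp contMDiff_snd))) p,
    (hΦ.tangentLift.contMDiff_act.comp
      (contMDiff_fst.prodMk (contMDiff_toTangent.comp contMDiff_snd))) p⟩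

theorem pairing_eq (z : CotangentTangentBundle I M) :
    pairing I M z = cov (toCotangent I M z).2 (toTangent I M z).2 := rfl

/-- The pairing is invariant. -/
theorem pairing_sumLift (hΦ : IsSmoothAction IG I Φ) (g : G) (z : CotangentTangentBundle I M) :
    pairing I M (sumLift I Φ g z) = pairing I M z := by
  rw [pairing_eq, toCotangent_sumLift, cov_cotangentLift]
  exact congrArg (cov z.2.1) (DFunLike.congr_fun (hΦ.mder_inv_comp g z.1) z.2.2)

end Sum

section Linear

/-! ### The linear models of the maps `b_ω` and `R` -/

variable (E : Type*) [NormedAddCommGroup E] [NormedSpace ℝ E]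

/-- The expression of `b_ω : TT*Q → T*T*Q` in coordinates,
`(q, p, δq, δp) ↦ (q, p, - δp dq + δq dp)`. -/
def flatLinear : (E × (E →L[ℝ] ℝ)) × (E × (E →L[ℝ] ℝ)) →ₗ[ℝ]
    (E × (E →L[ℝ] ℝ)) × ((E × (E →L[ℝ] ℝ)) →L[ℝ] ℝ) where
  toFun Y := (Y.1, (ContinuousLinearMap.apply ℝ ℝ Y.2.1) ∘L .snd ℝ E (E →L[ℝ] ℝ)
    - Y.2.2 ∘L .fst ℝ E (E →L[ℝ] ℝ))
  map_add' Y Z := by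
    refine Prod.ext rfl (ContinuousLinearMap.ext fun W => ?_)
    change W.2 (Y.2.1 + Z.2.1) - (Y.2.2 W.1 + Z.2.2 W.1) =
      (W.2 Y.2.1 - Y.2.2 W.1) + (W.2 Z.2.1 - Z.2.2 W.1)
    rw [map_add]
    ring
  map_smul' c Y := by
    refine Prod.ext rfl (ContinuousLinearMap.ext fun W => ?_)
    change W.2 (c • Y.2.1) - c * Y.2.2 W.1 = c * (W.2 Y.2.1 - Y.2.2 W.1)
    rw [map_smul, smul_eq_mul]
    ring

/-- The expression of `R : T*TQ → T*T*Q` in coordinates,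
`(q, v, a dq + b dv) ↦ (q, b, - a dq + v dp)`. -/
def tulczyjewLinear : (E × E) × ((E × E) →L[ℝ] ℝ) →ₗ[ℝ]
    (E × (E →L[ℝ] ℝ)) × ((E × (E →L[ℝ] ℝ)) →L[ℝ] ℝ) where
  toFun Y := ((Y.1.1, Y.2 ∘L .inr ℝ E E),
    (ContinuousLinearMap.apply ℝ ℝ Y.1.2) ∘L .snd ℝ E (E →L[ℝ] ℝ)
      - (Y.2 ∘L .inl ℝ E E) ∘L .fst ℝ E (E →L[ℝ] ℝ))
  map_add' Y Z := by
    refine Prod.ext rfl (ContinuousLinearMap.ext fun W => ?_)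
    change W.2 (Y.1.2 + Z.1.2) - (Y.2 (W.1, 0) + Z.2 (W.1, 0)) =
      (W.2 Y.1.2 - Y.2 (W.1, 0)) + (W.2 Z.1.2 - Z.2 (W.1, 0))
    rw [map_add]
    ring
  map_smul' c Y := by
    refine Prod.ext rfl (ContinuousLinearMap.ext fun W => ?_)
    change W.2 (c • Y.1.2) - c * Y.2 (W.1, 0) = c * (W.2 Y.1.2 - Y.2 (W.1, 0))
    rw [map_smul, smul_eq_mul]
    ring

variable {E}

theorem flatLinear_fst (Y : (E × (E →L[ℝ] ℝ)) × (E × (E →L[ℝ] ℝ))) : (flatLinear E Y).1 = Y.1 := rfl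

theorem flatLinear_snd (Y : (E × (E →L[ℝ] ℝ)) × (E × (E →L[ℝ] ℝ))) (W : E × (E →L[ℝ] ℝ)) :
    (flatLinear E Y).2 W = W.2 Y.2.1 - Y.2.2 W.1 := rfl

theorem tulczyjewLinear_fst (Y : (E × E) × ((E × E) →L[ℝ] ℝ)) :
    (tulczyjewLinear E Y).1 = (Y.1.1, Y.2 ∘L .inr ℝ E E) := rfl

theorem tulczyjewLinear_snd (Y : (E × E) × ((E × E) →L[ℝ] ℝ)) (W : E × (E →L[ℝ] ℝ)) :
    (tulczyjewLinear E Y).2 W = W.2 Y.1.2 - Y.2 (W.1, 0) := rfl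

theorem flatLinear_injective : Function.Injective (flatLinear E) := by
  rw [injective_iff_map_eq_zero]
  rintro ⟨Y, a, b⟩ h
  have h1 : Y = 0 := congrArg Prod.fst h
  have h2 : ∀ W : E × (E →L[ℝ] ℝ), W.2 a - b W.1 = 0 := fun W =>
    DFunLike.congr_fun (congrArg Prod.snd h) W
  have h3 : a = 0 := by
    refine SeparatingDual.eq_zero_of_forall_dual_eq_zero (R := ℝ) fun f => ?_
    simpa using h2 (0, f)
  have h4 : b = 0 := ContinuousLinearMap.ext fun w => by simpa using h2 (w, 0)
  rw [h1, h3, h4]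
  rfl

theorem tulczyjewLinear_injective : Function.Injective (tulczyjewLinear E) := by
  rw [injective_iff_map_eq_zero]
  rintro ⟨⟨q, v⟩, A⟩ h
  have h0 : (q, A ∘L .inr ℝ E E) = 0 := congrArg Prod.fst h
  have h1 : q = 0 := congrArg Prod.fst h0
  have h2 : A ∘L .inr ℝ E E = 0 := congrArg Prod.snd h0
  have h3 : ∀ W : E × (E →L[ℝ] ℝ), W.2 v - A (W.1, 0) = 0 := fun W =>
    DFunLike.congr_fun (congrArg Prod.snd h) W
  have h4 : v = 0 := by
    refine SeparatingDual.eq_zero_of_forall_dual_eq_zero (R := ℝ) fun f => ?_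
    have h := h3 (0, f)
    have h' : A ((0 : E), (0 : E)) = 0 := A.map_zero
    simpa [h'] using h
  have h5 : A = 0 := by
    refine ContinuousLinearMap.ext fun w => ?_
    have h6 : A (w.1, 0) = 0 := by simpa using h3 (w.1, 0)
    have h7 : A (0, w.2) = 0 := DFunLike.congr_fun h2 w.2
    have h8 : w = (w.1, 0) + (0, w.2) := by simp
    rw [h8, map_add, h6, h7]
    simp
  rw [h1, h4, h5]
  rfl

theorem finrank_clm (A : Type*) [NormedAddCommGroup A] [NormedSpace ℝ A] [FiniteDimensional ℝ A] :
    Module.finrank ℝ (A →L[ℝ] ℝ) = Module.finrank ℝ A := by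
  rw [← (LinearMap.toContinuousLinearMap (𝕜 := ℝ) (E := A) (F' := ℝ)).finrank_eq]
  exact Subspace.dual_finrank_eq

/-- An injective linear map between spaces of equal finite dimension, as a continuous linear
isomorphism. -/
def equivOfInjective {A B : Type*} [NormedAddCommGroup A] [NormedSpace ℝ A] [FiniteDimensional ℝ A]
    [NormedAddCommGroup B] [NormedSpace ℝ B] [FiniteDimensional ℝ B] (f : A →ₗ[ℝ] B)
    (hf : Function.Injective f) (h : Module.finrank ℝ A = Module.finrank ℝ B) : A ≃L[ℝ] B :=
  (LinearMap.linearEquivOfInjective f hf h).toContinuousLinearEquiv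

theorem finrank_prod_eq {A B C D : Type*} [NormedAddCommGroup A] [NormedSpace ℝ A]
    [FiniteDimensional ℝ A] [NormedAddCommGroup B] [NormedSpace ℝ B] [FiniteDimensional ℝ B]
    [NormedAddCommGroup C] [NormedSpace ℝ C] [FiniteDimensional ℝ C] [NormedAddCommGroup D]
    [NormedSpace ℝ D] [FiniteDimensional ℝ D]
    (h : Module.finrank ℝ A = Module.finrank ℝ C) (h' : Module.finrank ℝ B = Module.finrank ℝ D) :
    Module.finrank ℝ (A × B) = Module.finrank ℝ (C × D) := by
  rw [Module.finrank_prod, Module.finrank_prod, h, h']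

variable (E) [FiniteDimensional ℝ E]

set_option synthInstance.maxHeartbeats 400000 in
set_option maxHeartbeats 1000000 in
/-- The linear isomorphism `flatLinear`, with its continuity. -/
def flatEquiv : ((E × (E →L[ℝ] ℝ)) × (E × (E →L[ℝ] ℝ))) ≃L[ℝ]
    ((E × (E →L[ℝ] ℝ)) × ((E × (E →L[ℝ] ℝ)) →L[ℝ] ℝ)) :=
  equivOfInjective (A := (E × (E →L[ℝ] ℝ)) × (E × (E →L[ℝ] ℝ)))
    (B := (E × (E →L[ℝ] ℝ)) × ((E × (E →L[ℝ] ℝ)) →L[ℝ] ℝ)) (flatLinear E) flatLinear_injective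
    (finrank_prod_eq rfl (finrank_clm _).symm)

set_option synthInstance.maxHeartbeats 400000 in
set_option maxHeartbeats 1000000 in
/-- The linear isomorphism `tulczyjewLinear`, with its continuity. -/
def tulczyjewEquiv : ((E × E) × ((E × E) →L[ℝ] ℝ)) ≃L[ℝ]
    ((E × (E →L[ℝ] ℝ)) × ((E × (E →L[ℝ] ℝ)) →L[ℝ] ℝ)) :=
  equivOfInjective (A := (E × E) × ((E × E) →L[ℝ] ℝ))
    (B := (E × (E →L[ℝ] ℝ)) × ((E × (E →L[ℝ] ℝ)) →L[ℝ] ℝ)) (tulczyjewLinear E)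
    tulczyjewLinear_injective
    (finrank_prod_eq (finrank_prod_eq rfl (finrank_clm _).symm) ((finrank_clm _).trans
      ((finrank_prod_eq rfl (finrank_clm _).symm).trans (finrank_clm _).symm)))

theorem flatEquiv_apply (Y : (E × (E →L[ℝ] ℝ)) × (E × (E →L[ℝ] ℝ))) :
    flatEquiv E Y = flatLinear E Y := rfl

theorem tulczyjewEquiv_apply (Y : (E × E) × ((E × E) →L[ℝ] ℝ)) :
    tulczyjewEquiv E Y = tulczyjewLinear E Y := rfl

end Linear

section Flat

variable {E : Type*} [NormedAddCommGroup E] [NormedSpace ℝ E]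
  {H : Type*} [TopologicalSpace H] {I : ModelWithCorners ℝ E H} [I.Boundaryless]
  {M : Type*} [TopologicalSpace M] [ChartedSpace H M] [IsManifold I ∞ M]

/-! ### The map `b_ω` in charts -/

variable (I) in
/-- The zero of `T_q M`; the preferred chart of `TM` there lies over the one of `M` at `q`. -/
def tZero (q : M) : TangentBundle I M := ⟨q, 0⟩

variable (I) in
/-- The zero of `T*_q M`; the preferred chart of `T*M` there lies over the one of `M` at `q`. -/
def cZero (q : M) : CotangentBundle I M := ⟨q, 0⟩

theorem source_tangent_cotangent (q : M) :
    (extChartAt (cotangentModel I).tangent (tZero (cotangentModel I) (cZero I q))).source =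
      (fun V : TangentBundle (cotangentModel I) (CotangentBundle I M) => V.1.1) ⁻¹'
        (extChartAt I q).source := by
  rw [extChartAt_tangent_source, tZero, extChartAt_cotangent_source]
  rfl

theorem source_cotangent_cotangent (q : M) :
    (extChartAt (cotangentModel (cotangentModel I)) (cZero (cotangentModel I) (cZero I q))).source =
      (fun V : CotangentBundle (cotangentModel I) (CotangentBundle I M) => V.1.1) ⁻¹'
        (extChartAt I q).source := by
  rw [extChartAt_cotangent_source, cZero, extChartAt_cotangent_source]
  rfl

theorem source_cotangent_tangent (q : M) :
    (extChartAt (cotangentModel I.tangent) (cZero I.tangent (tZero I q))).source =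
      (fun V : CotangentBundle I.tangent (TangentBundle I M) => V.1.1) ⁻¹'
        (extChartAt I q).source := by
  rw [extChartAt_cotangent_source, cZero, extChartAt_tangent_source]
  rfl

theorem mem_target_tangent_cotangent (q : M) (Y : (E × (E →L[ℝ] ℝ)) × (E × (E →L[ℝ] ℝ))) :
    Y ∈ (extChartAt (cotangentModel I).tangent (tZero (cotangentModel I) (cZero I q))).target ↔
      Y.1.1 ∈ (extChartAt I q).target := by
  rw [extChartAt_tangent_target, tZero, extChartAt_cotangent_target]
  simp [cZero]

theorem mem_target_cotangent_cotangent (q : M)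
    (Y : (E × (E →L[ℝ] ℝ)) × ((E × (E →L[ℝ] ℝ)) →L[ℝ] ℝ)) :
    Y ∈ (extChartAt (cotangentModel (cotangentModel I))
      (cZero (cotangentModel I) (cZero I q))).target ↔ Y.1.1 ∈ (extChartAt I q).target := by
  rw [extChartAt_cotangent_target, cZero, extChartAt_cotangent_target]
  simp [cZero]

theorem mem_target_cotangent_tangent (q : M) (Y : (E × E) × ((E × E) →L[ℝ] ℝ)) :
    Y ∈ (extChartAt (cotangentModel I.tangent) (cZero I.tangent (tZero I q))).target ↔
      Y.1.1 ∈ (extChartAt I q).target := by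
  rw [extChartAt_cotangent_target, cZero, extChartAt_tangent_target]
  simp [tZero]

/-- In charts, `b_ω` is the linear map `flatLinear`. -/
theorem flat_canonicalForm_in_charts (q : M)
    (V : TangentBundle (cotangentModel I) (CotangentBundle I M))
    (h : V.1.1 ∈ (extChartAt I q).source) :
    extChartAt (cotangentModel (cotangentModel I)) (cZero (cotangentModel I) (cZero I q))
      (flat (cotangentModel I) (canonicalForm I M) V) =
    flatLinear E (extChartAt (cotangentModel I).tangent
      (tZero (cotangentModel I) (cZero I q)) V) := by
  have hV : V.1 ∈ (extChartAt (cotangentModel I) (cZero I q)).source := by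
    rw [extChartAt_cotangent_source]; exact h
  rw [extChartAt_cotangent (v₀ := cZero (cotangentModel I) (cZero I q))
    (v := flat (cotangentModel I) (canonicalForm I M) V) hV,
    extChartAt_tangent (v₀ := tZero (cotangentModel I) (cZero I q)) hV]
  refine Prod.ext rfl (ContinuousLinearMap.ext fun W => ?_)
  rw [flatLinear_snd]
  refine (canonicalForm_apply (α₀ := cZero I q) h V.2
    (chartDerivSymm (cotangentModel I) (cZero I q)
      (extChartAt (cotangentModel I) (cZero I q) V.1) W)).trans ?_
  rw [chartDeriv_symm_apply hV]
  rfl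

variable (I M) in
/-- `b_ω : TT*M → T*T*M` is a diffeomorphism. -/
theorem exists_diffeomorph_flat [FiniteDimensional ℝ E] :
    ∃ D : Diffeomorph (cotangentModel I).tangent (cotangentModel (cotangentModel I))
      (TangentBundle (cotangentModel I) (CotangentBundle I M))
      (CotangentBundle (cotangentModel I) (CotangentBundle I M)) ∞,
      ⇑D = flat (cotangentModel I) (canonicalForm I M) :=
  exists_diffeomorph_of_linear_in_charts (B := M) (U := fun q => (extChartAt I q).source)
    (b := fun V => V.1.1) (c := fun β => β.1.1)
    (s := fun q => tZero (cotangentModel I) (cZero I q))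
    (t := fun q => cZero (cotangentModel I) (cZero I q))
    (fun q => mem_extChartAt_source q) source_tangent_cotangent source_cotangent_cotangent
    (fun _ => rfl) (flatEquiv E)
    (fun q V h => (flat_canonicalForm_in_charts q V h).trans (flatEquiv_apply E _).symm)
    (fun q Y => by
      rw [mem_target_tangent_cotangent, mem_target_cotangent_cotangent, flatEquiv_apply,
        flatLinear_fst])

end Flat

section MapR

variable {E : Type*} [NormedAddCommGroup E] [NormedSpace ℝ E]
  {H : Type*} [TopologicalSpace H] {I : ModelWithCorners ℝ E H} [I.Boundaryless]
  {M : Type*} [TopologicalSpace M] [ChartedSpace H M] [IsManifold I ∞ M]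

/-! ### The map `R` in charts -/

/-- The fibre inclusion `T_x M → TM`. -/
def fibreInclusion (x : M) (u : E) : TangentBundle I M := ⟨x, u⟩

theorem contMDiff_fibreInclusion (x : M) :
    ContMDiff 𝓘(ℝ, E) I.tangent ∞ (fibreInclusion (I := I) x) := fun _ =>
  (contMDiffAt_tangent_iff (f := fibreInclusion (I := I) x) (x₀ := x)
    (mem_extChartAt_source (I := I) x)).2
    ⟨contMDiffAt_const, (chartDeriv I x x).contDiff.contMDiff.contMDiffAt⟩

/-- In charts, the vertical lift is `w ↦ (0, w)`. -/
theorem chartDeriv_verticalLift {q x : M} (hx : x ∈ (extChartAt I q).source) (v w : E) :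
    chartDeriv I.tangent (tZero I q) (fibreInclusion (I := I) x v) (verticalLift I x v w : E × E) =
      (0, chartDeriv I q x w) := by
  have h1 : ∀ u, fibreInclusion (I := I) x u ∈ (extChartAt I.tangent (tZero I q)).source :=
    fun u => by rw [extChartAt_tangent_source]; exact hx
  have h2 : HasFDerivAt (fun u : E => (extChartAt I q x, chartDeriv I q x u))
      (ContinuousLinearMap.prod 0 (chartDeriv I q x)) v :=
    (hasFDerivAt_const _ v).prodMk (chartDeriv I q x).hasFDerivAt
  have h := chartDeriv_comp_mder (I := 𝓘(ℝ, E)) (I' := I.tangent) (f := fibreInclusion (I := I) x)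
    (x := v) (x₀ := v) (z₀ := tZero I q) (F := fun u => (extChartAt I q x, chartDeriv I q x u))
    ((contMDiff_fibreInclusion x).mdifferentiable (by simp) v)
    (mem_extChartAt_source (I := 𝓘(ℝ, E)) v) (h1 v)
    h2.differentiableAt (Eventually.of_forall fun u => extChartAt_tangent (v₀ := tZero I q) hx)
  rw [chartDeriv_self] at h
  have h3 := DFunLike.congr_fun h w
  rw [ContinuousLinearMap.comp_id] at h3
  refine h3.trans ?_
  exact DFunLike.congr_fun h2.fderiv w

/-- The chart expression of `v^*`: `(q, v, a dq + b dv) ↦ (q, b)`. -/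
theorem vStar_in_charts {q : M} {α : CotangentBundle I.tangent (TangentBundle I M)}
    (h : α.1.1 ∈ (extChartAt I q).source) :
    extChartAt (cotangentModel I) (cZero I q) (vStar I α) =
      (tulczyjewLinear E (extChartAt (cotangentModel I.tangent)
        (cZero I.tangent (tZero I q)) α)).1 := by
  have hα : α.1 ∈ (extChartAt I.tangent (tZero I q)).source := by
    rw [extChartAt_tangent_source]; exact h
  rw [extChartAt_cotangent (v₀ := cZero I q) (v := vStar I α) h, tulczyjewLinear_fst,
    extChartAt_cotangent (v₀ := cZero I.tangent (tZero I q)) hα]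
  refine Prod.ext ?_ (ContinuousLinearMap.ext fun w => ?_)
  · exact (congrArg Prod.fst (extChartAt_tangent (v₀ := tZero I q) h)).symm
  · have h1 := chartDeriv_verticalLift h α.1.2 (chartDerivSymm I q (extChartAt I q α.1.1) w)
    rw [chartDeriv_symm_apply h] at h1
    have h2 := chartDerivSymm_apply hα (verticalLift I α.1.1 α.1.2
      (chartDerivSymm I q (extChartAt I q α.1.1) w) : E × E)
    exact congrArg (cov α.2) (h2.symm.trans
      (congrArg (chartDerivSymm I.tangent (tZero I q) (extChartAt I.tangent (tZero I q) α.1)) h1))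

/-- The condition that a covector `β` is the value of `R` at `α`; the tangent vectors of
`T*M ×_M TM` are taken in the model space. -/
def IsRAt (α : CotangentBundle I.tangent (TangentBundle I M))
    (β : CotangentBundle (cotangentModel I) (CotangentBundle I M)) : Prop :=
  β.1 = vStar I α ∧ ∀ z, toCotangent I M z = vStar I α → toTangent I M z = α.1 →
    ∀ Z : E × (E →L[ℝ] ℝ) × E,
      cov β.2 (mder (cotangentTangentModel I) (cotangentModel I) (toCotangent I M) z Z) =
        - cov α.2 (mder (cotangentTangentModel I) I.tangent (toTangent I M) z Z)
          + mder (cotangentTangentModel I) 𝓘(ℝ, ℝ) (pairing I M) z Z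

/-- The point of `T*M ×_M TM` over which `R α` is defined. -/
def sumPoint (α : CotangentBundle I.tangent (TangentBundle I M)) : CotangentTangentBundle I M :=
  ⟨α.1.1, ((vStar I α).2, α.1.2)⟩

theorem isR_iff {R : CotangentBundle I.tangent (TangentBundle I M) →
    CotangentBundle (cotangentModel I) (CotangentBundle I M)} :
    IsR I R ↔ ∀ α, IsRAt α (R α) := by
  refine forall_congr' fun α => ?_
  constructor
  · rintro ⟨β, hβ, h⟩
    rw [hβ]
    refine ⟨rfl, fun z hz hz' Z => ?_⟩
    obtain rfl : z = sumPoint α := sum_ext hz hz'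
    exact h Z
  · rintro ⟨hβ, h⟩
    generalize R α = b at hβ h
    obtain ⟨x, β⟩ := b
    obtain rfl : x = vStar I α := hβ
    exact ⟨β, rfl, fun Z => h (sumPoint α) rfl rfl Z⟩

variable (I) in
/-- The zero of the fibre of `T*M ×_M TM` over `q`. -/
def sZero (q : M) : CotangentTangentBundle I M := ⟨q, 0⟩

theorem chartDeriv_toCotangent {q : M} {z : CotangentTangentBundle I M}
    (h : z.1 ∈ (extChartAt I q).source) (Z : E × (E →L[ℝ] ℝ) × E) :
    chartDeriv (cotangentModel I) (cZero I q) (toCotangent I M z)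
      (mder (cotangentTangentModel I) (cotangentModel I) (toCotangent I M) z Z) =
    ((chartDeriv (cotangentTangentModel I) (sZero I q) z Z).1,
      (chartDeriv (cotangentTangentModel I) (sZero I q) z Z).2.1) := by
  have hz : z ∈ (extChartAt (cotangentTangentModel I) (sZero I q)).source := by
    rw [extChartAt_sum_source]; exact h
  let L : E × (E →L[ℝ] ℝ) × E →L[ℝ] E × (E →L[ℝ] ℝ) :=
    (ContinuousLinearMap.fst ℝ _ _).prod
      (ContinuousLinearMap.fst ℝ _ _ ∘L ContinuousLinearMap.snd ℝ _ _)
  have hL : ∀ Y, L Y = (Y.1, Y.2.1) := fun Y => rfl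
  have h1 := chartDeriv_comp_mder (x₀ := sZero I q) (z₀ := cZero I q) (F := L)
    (contMDiff_toCotangent.mdifferentiable (by simp) z) hz
    (by rw [extChartAt_cotangent_source]; exact h) L.differentiableAt (by
      filter_upwards [eventually_mem_source hz] with y hy
      rw [extChartAt_sum_source] at hy
      rw [hL, extChartAt_sum hy, extChartAt_cotangent (v₀ := cZero I q) (v := toCotangent I M y) hy]
      rfl)
  rw [L.fderiv] at h1
  exact DFunLike.congr_fun h1 Z

theorem chartDeriv_toTangent {q : M} {z : CotangentTangentBundle I M}
    (h : z.1 ∈ (extChartAt I q).source) (Z : E × (E →L[ℝ] ℝ) × E) :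
    chartDeriv I.tangent (tZero I q) (toTangent I M z)
      (mder (cotangentTangentModel I) I.tangent (toTangent I M) z Z) =
    ((chartDeriv (cotangentTangentModel I) (sZero I q) z Z).1,
      (chartDeriv (cotangentTangentModel I) (sZero I q) z Z).2.2) := by
  have hz : z ∈ (extChartAt (cotangentTangentModel I) (sZero I q)).source := by
    rw [extChartAt_sum_source]; exact h
  let L : E × (E →L[ℝ] ℝ) × E →L[ℝ] E × E :=
    (ContinuousLinearMap.fst ℝ _ _).prod
      (ContinuousLinearMap.snd ℝ _ _ ∘L ContinuousLinearMap.snd ℝ _ _)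
  have hL : ∀ Y, L Y = (Y.1, Y.2.2) := fun Y => rfl
  have h1 := chartDeriv_comp_mder (x₀ := sZero I q) (z₀ := tZero I q) (F := L)
    (contMDiff_toTangent.mdifferentiable (by simp) z) hz
    (by rw [extChartAt_tangent_source]; exact h) L.differentiableAt (by
      filter_upwards [eventually_mem_source hz] with y hy
      rw [extChartAt_sum_source] at hy
      rw [hL, extChartAt_sum hy, extChartAt_tangent (v₀ := tZero I q) (v := toTangent I M y) hy]
      rfl)
  rw [L.fderiv] at h1
  exact DFunLike.congr_fun h1 Z

/-- The pairing reads `(q, p, v) ↦ p v` in charts. -/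
theorem pairing_in_charts {q : M} {z : CotangentTangentBundle I M}
    (h : z.1 ∈ (extChartAt I q).source) :
    pairing I M z = (extChartAt (cotangentTangentModel I) (sZero I q) z).2.1
      (extChartAt (cotangentTangentModel I) (sZero I q) z).2.2 := by
  rw [extChartAt_sum h]
  exact congrArg (cov z.2.1) (chartDerivSymm_apply h z.2.2).symm

theorem hasFDerivAt_pairing (Y : E × (E →L[ℝ] ℝ) × E) :
    HasFDerivAt (fun Y : E × (E →L[ℝ] ℝ) × E => Y.2.1 Y.2.2)
      ((Y.2.1 ∘L (.snd ℝ (E →L[ℝ] ℝ) E) + (ContinuousLinearMap.apply ℝ ℝ Y.2.2) ∘L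
        (.fst ℝ (E →L[ℝ] ℝ) E)) ∘L .snd ℝ E ((E →L[ℝ] ℝ) × E)) Y := by
  have h1 : HasFDerivAt (fun Y : (E →L[ℝ] ℝ) × E => Y.1 Y.2)
      (Y.2.1 ∘L (.snd ℝ (E →L[ℝ] ℝ) E) + (ContinuousLinearMap.apply ℝ ℝ Y.2.2) ∘L
        (.fst ℝ (E →L[ℝ] ℝ) E)) Y.2 := by
    have h := (hasFDerivAt_fst (𝕜 := ℝ) (p := Y.2)).clm_apply (hasFDerivAt_snd (𝕜 := ℝ) (p := Y.2))
    refine h.congr_fderiv (ContinuousLinearMap.ext fun W => ?_)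
    simp
  exact h1.comp Y hasFDerivAt_snd

theorem pairing_eventuallyEq {q : M} {z : CotangentTangentBundle I M}
    (h : z.1 ∈ (extChartAt I q).source) :
    pairing I M =ᶠ[𝓝 z] (fun Y : E × (E →L[ℝ] ℝ) × E => Y.2.1 Y.2.2) ∘
      extChartAt (cotangentTangentModel I) (sZero I q) := by
  have hz : z ∈ (extChartAt (cotangentTangentModel I) (sZero I q)).source := by
    rw [extChartAt_sum_source]; exact h
  filter_upwards [eventually_mem_source hz] with y hy
  rw [extChartAt_sum_source] at hy
  exact pairing_in_charts hy

theorem mdifferentiable_pairing :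
    MDifferentiable (cotangentTangentModel I) 𝓘(ℝ, ℝ) (pairing I M) := fun z => by
  have hz := mem_extChartAt_source (I := I) z.1
  have hz' : z ∈ (extChartAt (cotangentTangentModel I) (sZero I z.1)).source := by
    rw [extChartAt_sum_source]; exact hz
  refine MDifferentiableAt.congr_of_eventuallyEq ?_ (pairing_eventuallyEq hz)
  exact (hasFDerivAt_pairing _).differentiableAt.mdifferentiableAt.comp z
    (mdifferentiableAt_extChart hz')

/-- In charts, the derivative of the pairing is `(δq, δp, δv) ↦ p δv + δp v`. -/
theorem mder_pairing {q : M} {z : CotangentTangentBundle I M}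
    (h : z.1 ∈ (extChartAt I q).source) (Z : E × (E →L[ℝ] ℝ) × E) :
    mder (cotangentTangentModel I) 𝓘(ℝ, ℝ) (pairing I M) z Z =
      (extChartAt (cotangentTangentModel I) (sZero I q) z).2.1
        (chartDeriv (cotangentTangentModel I) (sZero I q) z Z).2.2 +
      (chartDeriv (cotangentTangentModel I) (sZero I q) z Z).2.1
        (extChartAt (cotangentTangentModel I) (sZero I q) z).2.2 := by
  have hz : z ∈ (extChartAt (cotangentTangentModel I) (sZero I q)).source := by
    rw [extChartAt_sum_source]; exact h
  rw [mder_congr (pairing_eventuallyEq h), mder_comp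
    (hasFDerivAt_pairing _).differentiableAt.mdifferentiableAt (mdifferentiableAt_extChart hz),
    mder_vectorSpace, (hasFDerivAt_pairing _).fderiv]
  rfl


/-- In charts, the point `(v^* α, v)` for `α = (q, v, a dq + b dv)` is `(q, b, v)`. -/
theorem extChartAt_sumPoint {q : M} {α : CotangentBundle I.tangent (TangentBundle I M)}
    (h : α.1.1 ∈ (extChartAt I q).source) :
    (extChartAt (cotangentTangentModel I) (sZero I q) (sumPoint α)).2 =
      ((extChartAt (cotangentModel I.tangent) (cZero I.tangent (tZero I q)) α).2 ∘L .inr ℝ E E,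
        (extChartAt (cotangentModel I.tangent) (cZero I.tangent (tZero I q)) α).1.2) := by
  have hα : α.1 ∈ (extChartAt I.tangent (tZero I q)).source := by
    rw [extChartAt_tangent_source]; exact h
  have h1 := congrArg Prod.snd (vStar_in_charts h)
  rw [extChartAt_cotangent (v₀ := cZero I q) (v := vStar I α) h, tulczyjewLinear_fst] at h1
  rw [extChartAt_sum (v₀ := sZero I q) (v := sumPoint α) h]
  refine Prod.ext h1 ?_
  rw [extChartAt_cotangent (v₀ := cZero I.tangent (tZero I q)) hα]
  exact (congrArg Prod.snd (extChartAt_tangent (v₀ := tZero I q) h)).symm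

/-- The right hand side of the equation for `R α` in charts; it depends only on the component of
`Z` in `T T*M`. -/
theorem neg_eval_add_mder_pairing {q : M} {α : CotangentBundle I.tangent (TangentBundle I M)}
    (h : α.1.1 ∈ (extChartAt I q).source) (Z : E × (E →L[ℝ] ℝ) × E) :
    - cov α.2 (mder (cotangentTangentModel I) I.tangent (toTangent I M) (sumPoint α) Z)
          + mder (cotangentTangentModel I) 𝓘(ℝ, ℝ) (pairing I M) (sumPoint α) Z =
      (tulczyjewLinear E (extChartAt (cotangentModel I.tangent) (cZero I.tangent (tZero I q)) α)).2
        ((chartDeriv (cotangentTangentModel I) (sZero I q) (sumPoint α) Z).1,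
          (chartDeriv (cotangentTangentModel I) (sZero I q) (sumPoint α) Z).2.1) := by
  have hα : α.1 ∈ (extChartAt I.tangent (tZero I q)).source := by
    rw [extChartAt_tangent_source]; exact h
  have h1 := chartDerivSymm_apply hα
    (mder (cotangentTangentModel I) I.tangent (toTangent I M) (sumPoint α) Z)
  have h2 := chartDeriv_toTangent (z := sumPoint α) h Z
  have h3 := h1.symm.trans (congrArg (chartDerivSymm I.tangent (tZero I q)
    (extChartAt I.tangent (tZero I q) α.1)) h2)
  rw [mder_pairing (z := sumPoint α) h, extChartAt_sumPoint h, h3, tulczyjewLinear_snd]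
  generalize chartDeriv (cotangentTangentModel I) (sZero I q) (sumPoint α) Z = δ
  have h4 : ∀ W, (extChartAt (cotangentModel I.tangent) (cZero I.tangent (tZero I q)) α).2 W =
      cov α.2 (chartDerivSymm I.tangent (tZero I q)
        (extChartAt I.tangent (tZero I q) α.1) W) := fun W => by
    rw [extChartAt_cotangent (v₀ := cZero I.tangent (tZero I q)) hα]
    rfl
  rw [← h4]
  generalize extChartAt (cotangentModel I.tangent) (cZero I.tangent (tZero I q)) α = Y
  have h5 : Y.2 (δ.1, δ.2.2) = Y.2 (δ.1, 0) + Y.2 (0, δ.2.2) := by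
    rw [← map_add]; simp
  have h6 : (Y.2 ∘L ContinuousLinearMap.inr ℝ E E) δ.2.2 = Y.2 (0, δ.2.2) := rfl
  rw [h5, h6]
  ring

/-- The equation for a covector `β` over `v^* α` in charts. The tangent vectors `W` of `T*M` are the
images of the vectors `Z = (W, 0)` of `T*M ×_M TM`. -/
theorem forall_mder_iff_in_charts {q : M} {α : CotangentBundle I.tangent (TangentBundle I M)}
    {β : CotangentBundle (cotangentModel I) (CotangentBundle I M)}
    (h : α.1.1 ∈ (extChartAt I q).source) (hβ : β.1 = vStar I α) :
    (∀ z, toCotangent I M z = vStar I α → toTangent I M z = α.1 → ∀ Z : E × (E →L[ℝ] ℝ) × E,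
      cov β.2 (mder (cotangentTangentModel I) (cotangentModel I) (toCotangent I M) z Z) =
        - cov α.2 (mder (cotangentTangentModel I) I.tangent (toTangent I M) z Z)
          + mder (cotangentTangentModel I) 𝓘(ℝ, ℝ) (pairing I M) z Z) ↔
      cov β.2 ∘L chartDerivSymm (cotangentModel I) (cZero I q)
        (extChartAt (cotangentModel I) (cZero I q) β.1) =
      (tulczyjewLinear E (extChartAt (cotangentModel I.tangent)
        (cZero I.tangent (tZero I q)) α)).2 := by
  obtain ⟨x, β⟩ := β
  obtain rfl : x = vStar I α := hβ
  have hv : vStar I α ∈ (extChartAt (cotangentModel I) (cZero I q)).source := by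
    rw [extChartAt_cotangent_source]; exact h
  have hz : sumPoint α ∈ (extChartAt (cotangentTangentModel I) (sZero I q)).source := by
    rw [extChartAt_sum_source]; exact h
  have h1 : ∀ Z : E × (E →L[ℝ] ℝ) × E,
      mder (cotangentTangentModel I) (cotangentModel I) (toCotangent I M) (sumPoint α) Z =
      chartDerivSymm (cotangentModel I) (cZero I q)
        (extChartAt (cotangentModel I) (cZero I q) (vStar I α))
        ((chartDeriv (cotangentTangentModel I) (sZero I q) (sumPoint α) Z).1,
          (chartDeriv (cotangentTangentModel I) (sZero I q) (sumPoint α) Z).2.1) := fun Z =>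
    (chartDerivSymm_apply hv _).symm.trans
      (congrArg (chartDerivSymm (cotangentModel I) (cZero I q)
        (extChartAt (cotangentModel I) (cZero I q) (vStar I α)))
        (chartDeriv_toCotangent (z := sumPoint α) h Z))
  constructor
  · intro H
    refine ContinuousLinearMap.ext fun W => ?_
    have h2 := H (sumPoint α) rfl rfl (chartDerivSymm (cotangentTangentModel I) (sZero I q)
      (extChartAt (cotangentTangentModel I) (sZero I q) (sumPoint α)) (W.1, W.2, 0))
    rw [neg_eval_add_mder_pairing h, h1, chartDeriv_symm_apply hz] at h2
    exact h2
  · intro H z hz1 hz2 Z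
    obtain rfl : z = sumPoint α := sum_ext hz1 hz2
    rw [neg_eval_add_mder_pairing h, h1]
    exact DFunLike.congr_fun H _

/-- In charts, the condition on the value `β = R α` reads `β = tulczyjewLinear α`. -/
theorem isRAt_iff_in_charts {q : M} {α : CotangentBundle I.tangent (TangentBundle I M)}
    {β : CotangentBundle (cotangentModel I) (CotangentBundle I M)}
    (hα : α.1.1 ∈ (extChartAt I q).source) (hβ : β.1.1 ∈ (extChartAt I q).source) :
    IsRAt α β ↔
      extChartAt (cotangentModel (cotangentModel I)) (cZero (cotangentModel I) (cZero I q)) β =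
        tulczyjewLinear E (extChartAt (cotangentModel I.tangent)
          (cZero I.tangent (tZero I q)) α) := by
  have hβ' : β.1 ∈ (extChartAt (cotangentModel I) (cZero I q)).source := by
    rw [extChartAt_cotangent_source]; exact hβ
  have hv : vStar I α ∈ (extChartAt (cotangentModel I) (cZero I q)).source := by
    rw [extChartAt_cotangent_source]; exact hα
  have hbase : β.1 = vStar I α ↔ extChartAt (cotangentModel I) (cZero I q) β.1 =
      (tulczyjewLinear E (extChartAt (cotangentModel I.tangent)
        (cZero I.tangent (tZero I q)) α)).1 := by
    rw [← vStar_in_charts hα]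
    exact ⟨fun h => by rw [h], fun h => (extChartAt (cotangentModel I) (cZero I q)).injOn hβ' hv h⟩
  rw [extChartAt_cotangent (v₀ := cZero (cotangentModel I) (cZero I q)) hβ', Prod.ext_iff]
  exact (and_congr_right fun h => forall_mder_iff_in_charts hα h).trans (and_congr_left' hbase)

end MapR

section DiffeomorphismR

variable {E : Type*} [NormedAddCommGroup E] [NormedSpace ℝ E]
  {H : Type*} [TopologicalSpace H] {I : ModelWithCorners ℝ E H} [I.Boundaryless]
  {M : Type*} [TopologicalSpace M] [ChartedSpace H M] [IsManifold I ∞ M]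

/-! ### The diffeomorphism `R` -/

/-- The value of `R` at `α`, by its expression in the chart at the base point of `α`. -/
def valueR (α : CotangentBundle I.tangent (TangentBundle I M)) :
    CotangentBundle (cotangentModel I) (CotangentBundle I M) :=
  ⟨vStar I α, (tulczyjewLinear E (extChartAt (cotangentModel I.tangent)
      (cZero I.tangent (tZero I α.1.1)) α)).2 ∘L
    chartDeriv (cotangentModel I) (cZero I α.1.1) (vStar I α)⟩

/-- The equations for `R` have a solution. -/
theorem isRAt_valueR (α : CotangentBundle I.tangent (TangentBundle I M)) :
    IsRAt α (valueR α) := by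
  have h : α.1.1 ∈ (extChartAt I α.1.1).source := mem_extChartAt_source _
  have hv : vStar I α ∈ (extChartAt (cotangentModel I) (cZero I α.1.1)).source := by
    rw [extChartAt_cotangent_source]; exact h
  refine (isRAt_iff_in_charts (q := α.1.1) h h).2 ?_
  rw [extChartAt_cotangent (v₀ := cZero (cotangentModel I) (cZero I α.1.1)) (v := valueR α) hv]
  refine Prod.ext (vStar_in_charts h) (ContinuousLinearMap.ext fun W => ?_)
  exact congrArg (tulczyjewLinear E (extChartAt (cotangentModel I.tangent)
      (cZero I.tangent (tZero I α.1.1)) α)).2 (chartDeriv_symm_apply hv W)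

theorem IsRAt.base_eq {α : CotangentBundle I.tangent (TangentBundle I M)}
    {β : CotangentBundle (cotangentModel I) (CotangentBundle I M)} (h : IsRAt α β) :
    β.1.1 = α.1.1 := congrArg TotalSpace.proj h.1

theorem IsRAt.in_charts {α : CotangentBundle I.tangent (TangentBundle I M)}
    {β : CotangentBundle (cotangentModel I) (CotangentBundle I M)} (h : IsRAt α β) {q : M}
    (hq : α.1.1 ∈ (extChartAt I q).source) :
    extChartAt (cotangentModel (cotangentModel I)) (cZero (cotangentModel I) (cZero I q)) β =
      tulczyjewLinear E (extChartAt (cotangentModel I.tangent)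
        (cZero I.tangent (tZero I q)) α) :=
  (isRAt_iff_in_charts hq (by rw [h.base_eq]; exact hq)).1 h

/-- The equations for `R` determine its values. -/
theorem IsRAt.unique {α : CotangentBundle I.tangent (TangentBundle I M)}
    {β γ : CotangentBundle (cotangentModel I) (CotangentBundle I M)} (h : IsRAt α β)
    (h' : IsRAt α γ) : β = γ := by
  have hq : α.1.1 ∈ (extChartAt I α.1.1).source := mem_extChartAt_source _
  refine (extChartAt (cotangentModel (cotangentModel I))
    (cZero (cotangentModel I) (cZero I α.1.1))).injOn ?_ ?_
    ((h.in_charts hq).trans (h'.in_charts hq).symm)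
  · rw [source_cotangent_cotangent, mem_preimage, h.base_eq]; exact hq
  · rw [source_cotangent_cotangent, mem_preimage, h'.base_eq]; exact hq

variable (I M) in
/-- The values of `R` are those of a diffeomorphism. -/
theorem exists_diffeomorph_isRAt [FiniteDimensional ℝ E] :
    ∃ D : Diffeomorph (cotangentModel I.tangent) (cotangentModel (cotangentModel I))
      (CotangentBundle I.tangent (TangentBundle I M))
      (CotangentBundle (cotangentModel I) (CotangentBundle I M)) ∞, ∀ α, IsRAt α (D α) := by
  obtain ⟨D, hD⟩ := exists_diffeomorph_of_linear_in_charts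
    (I := cotangentModel I.tangent) (I' := cotangentModel (cotangentModel I))
    (f := valueR) (B := M) (U := fun q => (extChartAt I q).source)
    (b := fun α : CotangentBundle I.tangent (TangentBundle I M) => α.1.1)
    (c := fun β : CotangentBundle (cotangentModel I) (CotangentBundle I M) => β.1.1)
    (s := fun q => cZero I.tangent (tZero I q))
    (t := fun q => cZero (cotangentModel I) (cZero I q))
    (fun q => mem_extChartAt_source q) source_cotangent_tangent source_cotangent_cotangent
    (fun _ => rfl) (tulczyjewEquiv E)
    (fun q α h => ((isRAt_valueR α).in_charts h).trans (tulczyjewEquiv_apply E _).symm)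
    (fun q Y => by
      rw [mem_target_cotangent_tangent, mem_target_cotangent_cotangent, tulczyjewEquiv_apply,
        tulczyjewLinear_fst])
  exact ⟨D, fun α => by rw [hD]; exact isRAt_valueR α⟩

/-- The equations for `R` determine the map `R`. -/
theorem isR_iff_eq {f : CotangentBundle I.tangent (TangentBundle I M) →
    CotangentBundle (cotangentModel I) (CotangentBundle I M)} (hf : ∀ α, IsRAt α (f α))
    (R : CotangentBundle I.tangent (TangentBundle I M) →
      CotangentBundle (cotangentModel I) (CotangentBundle I M)) : IsR I R ↔ R = f := by
  rw [isR_iff]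
  exact ⟨fun h => funext fun α => (h α).unique (hf α), fun h => h ▸ hf⟩

end DiffeomorphismR

section Equivariance

variable {EG : Type*} [NormedAddCommGroup EG] [NormedSpace ℝ EG]
  {HG : Type*} [TopologicalSpace HG] {IG : ModelWithCorners ℝ EG HG} [IG.Boundaryless]
  {G : Type*} [TopologicalSpace G] [ChartedSpace HG G] [Group G] [LieGroup IG ∞ G]
  {E : Type*} [NormedAddCommGroup E] [NormedSpace ℝ E]
  {H : Type*} [TopologicalSpace H] {I : ModelWithCorners ℝ E H} [I.Boundaryless]
  {M : Type*} [TopologicalSpace M] [ChartedSpace H M] [IsManifold I ∞ M]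
  {Φ : G → M → M}

/-! ### Equivariance of `R` -/

/-- Tangent lifts map vertical lifts to vertical lifts, because they are linear on fibres. The
vertical lift is written as the derivative of the fibre inclusion. -/
theorem mder_tangentLift_verticalLift (hΦ : IsSmoothAction IG I Φ) (g : G) (x : M) (v w : E) :
    mder I.tangent I.tangent (tangentLift I Φ g) (fibreInclusion (I := I) x v)
      (mder 𝓘(ℝ, E) I.tangent (fibreInclusion (I := I) x) v w) =
    mder 𝓘(ℝ, E) I.tangent (fibreInclusion (I := I) (Φ g x)) (mder I I (Φ g) x v)
      (mder I I (Φ g) x w) := by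
  have h1 := mder_comp (I := 𝓘(ℝ, E)) (I' := I.tangent) (I'' := I.tangent)
    (g := tangentLift I Φ g) (f := fibreInclusion (I := I) x) (x := v)
    (hΦ.tangentLift.mdifferentiable g _) ((contMDiff_fibreInclusion x).mdifferentiable (by simp) v)
  have h2 := mder_comp (I := 𝓘(ℝ, E)) (I' := 𝓘(ℝ, E)) (I'' := I.tangent)
    (g := fibreInclusion (I := I) (Φ g x)) (f := mder I I (Φ g) x) (x := v)
    ((contMDiff_fibreInclusion (I := I) (Φ g x)).mdifferentiable (by simp) _)
    (mder I I (Φ g) x).differentiableAt.mdifferentiableAt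
  rw [mder_vectorSpace, (mder I I (Φ g) x).fderiv] at h2
  have h3 : tangentLift I Φ g ∘ fibreInclusion (I := I) x =
      fibreInclusion (I := I) (Φ g x) ∘ mder I I (Φ g) x := rfl
  rw [h3] at h1
  exact DFunLike.congr_fun (h1.symm.trans h2) w

/-- The projection `v^*` is equivariant. -/
theorem vStar_cotangentLift (hΦ : IsSmoothAction IG I Φ) (g : G)
    (α : CotangentBundle I.tangent (TangentBundle I M)) :
    vStar I (cotangentLift I.tangent (tangentLift I Φ) g α) =
      cotangentLift I Φ g (vStar I α) := by
  refine cotangent_ext rfl (ContinuousLinearMap.ext fun w => ?_)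
  have h := mder_tangentLift_verticalLift hΦ g⁻¹ (Φ g α.1.1) (mder I I (Φ g) α.1.1 α.1.2) w
  have h1 : mder I I (Φ g⁻¹) (Φ g α.1.1) (mder I I (Φ g) α.1.1 α.1.2) = α.1.2 :=
    DFunLike.congr_fun (hΦ.mder_inv_comp g α.1.1) α.1.2
  rw [h1, hΦ.inv_act] at h
  exact congrArg (cov α.2) h

/-- The equations for `R` are equivariant: the vectors `Z` at `g z` are moved to `z` by the
action of `g⁻¹` on `T*M ×_M TM`. -/
theorem IsRAt.cotangentLift (hΦ : IsSmoothAction IG I Φ)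
    {α : CotangentBundle I.tangent (TangentBundle I M)}
    {β : CotangentBundle (cotangentModel I) (CotangentBundle I M)} (h : IsRAt α β) (g : G) :
    IsRAt (Tulczyjew.cotangentLift I.tangent (tangentLift I Φ) g α)
      (Tulczyjew.cotangentLift (cotangentModel I) (Tulczyjew.cotangentLift I Φ) g β) := by
  refine ⟨?_, fun z hz hz' Z => ?_⟩
  · rw [vStar_cotangentLift hΦ, cotangentLift_fst, h.1]
  · have hS := isSmoothAction_sumLift hΦ
    have hT := hΦ.tangentLift
    have hC := hΦ.cotangentLift
    rw [vStar_cotangentLift hΦ] at hz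
    have h1 : toCotangent I M (sumLift I Φ g⁻¹ z) = vStar I α := by
      rw [toCotangent_sumLift, hz, hC.inv_act]
    have h2 : toTangent I M (sumLift I Φ g⁻¹ z) = α.1 := by
      rw [toTangent_sumLift, hz']
      exact hT.inv_act g α.1
    have h3 := h.2 _ h1 h2 (mder (cotangentTangentModel I) (cotangentTangentModel I)
      (sumLift I Φ g⁻¹) z Z)
    have hSd := hS.mdifferentiable g⁻¹ z
    have hCd := contMDiff_toCotangent (I := I) (M := M) |>.mdifferentiable (by simp)
    have hTd := contMDiff_toTangent (I := I) (M := M) |>.mdifferentiable (by simp)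
    -- differentiate the equivariance of the two projections and the invariance of the pairing
    have e1 := (mder_comp (hCd _) hSd).symm.trans
      ((congrArg (fun k => mder (cotangentTangentModel I) (cotangentModel I) k z)
        (funext (toCotangent_sumLift (I := I) (Φ := Φ) g⁻¹))).trans
        (mder_comp (hC.mdifferentiable g⁻¹ _) (hCd z)))
    have e2 := (mder_comp (hTd _) hSd).symm.trans
      ((congrArg (fun k => mder (cotangentTangentModel I) I.tangent k z)
        (funext (toTangent_sumLift (I := I) (Φ := Φ) g⁻¹))).trans
        (mder_comp (hT.mdifferentiable g⁻¹ _) (hTd z)))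
    have e3 := (mder_comp (mdifferentiable_pairing _) hSd).symm.trans
      (congrArg (fun k => mder (cotangentTangentModel I) 𝓘(ℝ, ℝ) k z)
        (funext (pairing_sumLift hΦ g⁻¹)))
    have e1' := DFunLike.congr_fun e1 Z
    have e2' := DFunLike.congr_fun e2 Z
    have e3' := DFunLike.congr_fun e3 Z
    simp only [ContinuousLinearMap.comp_apply] at e1' e2' e3'
    rw [e1', e2', e3', hz, hz', ← h.1] at h3
    exact h3

/-- The momentum maps of `T*T*M` and `T*TM` are related by `R`: the pairing is constant along the
orbits of `G` in `T*M ×_M TM`. -/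
theorem IsRAt.cotangentMomentum_eq (hΦ : IsSmoothAction IG I Φ)
    {α : CotangentBundle I.tangent (TangentBundle I M)}
    {β : CotangentBundle (cotangentModel I) (CotangentBundle I M)} (h : IsRAt α β) :
    cotangentMomentum IG (cotangentModel I) (Tulczyjew.cotangentLift I Φ) β =
      - cotangentMomentum IG I.tangent (tangentLift I Φ) α := by
  refine ContinuousLinearMap.ext fun ξ => ?_
  have hS := isSmoothAction_sumLift hΦ
  have h1 := h.2 (sumPoint α) rfl rfl (mder IG (cotangentTangentModel I)
    (fun g => sumLift I Φ g (sumPoint α)) 1 ξ)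
  have e1 := hS.mder_generator (contMDiff_toCotangent.mdifferentiable (by simp) (sumPoint α))
    (fun g => toCotangent_sumLift (I := I) (Φ := Φ) g (sumPoint α)) ξ
  have e2 := hS.mder_generator (contMDiff_toTangent.mdifferentiable (by simp) (sumPoint α))
    (fun g => toTangent_sumLift (I := I) (Φ := Φ) g (sumPoint α)) ξ
  have e3 := hS.mder_generator (mdifferentiable_pairing (sumPoint α)) (Ψ := fun _ r => r)
    (fun g => pairing_sumLift hΦ g (sumPoint α)) ξ
  -- the pairing is constant along the orbit of `sumPoint α`
  have e4 : mder IG 𝓘(ℝ, ℝ) (fun _ : G => pairing I M (sumPoint α)) 1 ξ = 0 :=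
    DFunLike.congr_fun mfderiv_const ξ
  rw [e1, e2, e3, e4, add_zero] at h1
  have e5 : toCotangent I M (sumPoint α) = β.1 := h.1.symm
  rw [e5] at h1
  exact h1

end Equivariance

end Tulczyjew

end

set_option maxHeartbeats 1000000 in
theorem theorem6p2
    {E : Type*} [NormedAddCommGroup E] [NormedSpace ℝ E] [FiniteDimensional ℝ E]
    {Q : Type*} [TopologicalSpace Q] [ChartedSpace E Q] [IsManifold 𝓘(ℝ, E) ∞ Q]
    {EG : Type*} [NormedAddCommGroup EG] [NormedSpace ℝ EG] [FiniteDimensional ℝ EG]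
    {G : Type*} [TopologicalSpace G] [ChartedSpace EG G] [Group G] [LieGroup 𝓘(ℝ, EG) ∞ G]
    [MulAction G Q] [ContMDiffSMul 𝓘(ℝ, EG) 𝓘(ℝ, E) ∞ G Q] :
    -- the models of `TQ` and `T*Q`
    let I := 𝓘(ℝ, E)
    let IT := I.tangent
    let IC := cotangentModel I
    -- the action on `Q` and its lifts to `TQ`, `T*Q`, `TT*Q`, `T*TQ` and `T*T*Q`
    let ΦQ : G → Q → Q := fun g q => g • q
    let ΦT : G → TangentBundle I Q → TangentBundle I Q := tangentLift I ΦQ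
    let ΦC : G → CotangentBundle I Q → CotangentBundle I Q := cotangentLift I ΦQ
    let ΦTC : G → TangentBundle IC (CotangentBundle I Q) → TangentBundle IC (CotangentBundle I Q) :=
      tangentLift IC ΦC
    let ΦCT : G → CotangentBundle IT (TangentBundle I Q) → CotangentBundle IT (TangentBundle I Q) :=
      cotangentLift IT ΦT
    let ΦCC : G → CotangentBundle IC (CotangentBundle I Q) →
        CotangentBundle IC (CotangentBundle I Q) := cotangentLift IC ΦC
    -- the momentum maps on `TT*Q`, `T*TQ` and `T*T*Q`
    let JTC : TangentBundle IC (CotangentBundle I Q) → EG →L[ℝ] ℝ :=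
      tangentMomentum IC (cotangentMomentum 𝓘(ℝ, EG) I ΦQ)
    let JCT : CotangentBundle IT (TangentBundle I Q) → EG →L[ℝ] ℝ :=
      cotangentMomentum 𝓘(ℝ, EG) IT ΦT
    let JCC : CotangentBundle IC (CotangentBundle I Q) → EG →L[ℝ] ℝ :=
      cotangentMomentum 𝓘(ℝ, EG) IC ΦC
    -- the lifted actions on `TT*Q` and `T*TQ` are Hamiltonian
    IsHamiltonianAction 𝓘(ℝ, EG) IC.tangent (completeLift IC (canonicalForm I Q)) ΦTC JTC ∧
    IsHamiltonianAction 𝓘(ℝ, EG) (cotangentModel IT) (canonicalForm IT (TangentBundle I Q))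
      ΦCT JCT ∧
    -- the diffeomorphisms `R` and `A_Q = R⁻¹ ∘ b_{ω_Q}`
    ∃ R : Diffeomorph (cotangentModel IT) (cotangentModel IC)
        (CotangentBundle IT (TangentBundle I Q)) (CotangentBundle IC (CotangentBundle I Q)) ∞,
    ∃ A : Diffeomorph IC.tangent (cotangentModel IT)
        (TangentBundle IC (CotangentBundle I Q)) (CotangentBundle IT (TangentBundle I Q)) ∞,
      (∀ R' : CotangentBundle IT (TangentBundle I Q) → CotangentBundle IC (CotangentBundle I Q),
        IsR I R' ↔ R' = ⇑R) ∧
      (∀ V, A V = R.symm (flat IC (canonicalForm I Q) V)) ∧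
      -- the map `R`
      (∀ g α, R (ΦCT g α) = ΦCC g (R α)) ∧
      (∀ α, JCC (R α) = - JCT α) ∧
      -- equivariance of `A_Q`, and its compatibility with the momentum maps
      (∀ g V, A (ΦTC g V) = ΦCT g (A V)) ∧
      JTC = JCT ∘ A := by
  intro I IT IC ΦQ ΦT ΦC ΦTC ΦCT ΦCC JTC JCT JCC
  have hΦ : IsSmoothAction 𝓘(ℝ, EG) I ΦQ := ⟨one_smul G, mul_smul, contMDiff_smul⟩
  have hC := isHamiltonianAction_cotangentLift hΦ
  obtain ⟨B, hB⟩ := exists_diffeomorph_flat I Q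
  obtain ⟨R, hR⟩ := exists_diffeomorph_isRAt I Q
  have hRequiv : ∀ g α, R (ΦCT g α) = ΦCC g (R α) := fun g α =>
    (hR _).unique ((hR α).cotangentLift hΦ g)
  have hRJ : ∀ α, JCC (R α) = - JCT α := fun α => (hR α).cotangentMomentum_eq hΦ
  -- `A = R⁻¹ ∘ b_ω`, and `B` is `b_ω`
  have hA : ∀ V, R ((B.trans R.symm) V) = flat IC (canonicalForm I Q) V := fun V =>
    (R.apply_symm_apply _).trans (congrFun hB V)
  refine ⟨hC.tangentLift canonicalForm_antisymm (hB ▸ B.contMDiff),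
    isHamiltonianAction_cotangentLift hΦ.tangentLift, R, B.trans R.symm, isR_iff_eq hR,
    fun V => congrArg R.symm (congrFun hB V), hRequiv, hRJ, fun g V => ?_, funext fun V => ?_⟩
  · exact R.injective ((hA _).trans ((hC.flat_tangentLift g V).trans
      ((congrArg (ΦCC g) (hA V).symm).trans (hRequiv g _).symm)))
  · refine neg_injective ?_
    exact (hC.cotangentMomentum_flat canonicalForm_antisymm V).symm.trans
      ((congrArg JCC (hA V).symm).trans (hRJ _))
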